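/- Let $n\ge 0$ be an integer, let $\beta>n$ be real, and let $\Omega\subset\mathbb{R}^n$ be open and convex. Let $V:\Omega\to(0,\infty)$ be a twice continuously differentiable convex function whose Hessian $V''(x)$ is positive definite for every $x\in\Omega$. Assume that the measure $\mu$ concentrated on $\Omega$ with density $d\mu(x)/dx=V(x)^{-\beta}$, $x\in\Omega$, is a probability measure. Then for every smooth ($C^\infty$) function $g:\Omega\to\mathbb{R}$ with $\int g^2\,d\mu<\infty$, writing $G=Vg$, $$(\beta+1)\,\mathrm{Var}_\mu(g)\;\le\;\int_\Omega \frac{\langle V''^{-1}\nabla G,\nabla G\rangle}{V}\,d\mu\;+\;\frac{n}{\beta-n}\Big(\int_\Omega g\,d\mu\Big)^2 ,$$ where $\mathrm{Var}_\mu(g)=\int g^2\,d\mu-\big(\int g\,d\mu\big)^2$ and the first integral on the right, whose integrand is non-negative, may be $+\infty$ (the inequality is then trivial). In particular, if $\int_\Omega g\,d\mu=0$, then $$\mathrm{Var}_\mu(g)\;\le\;\frac{1}{\beta+1}\int_\Omega \frac{\langle V''^{-1}\nabla G,\nabla G\rangle}{V}\,d\mu .$$ -/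

import Mathlib

open MeasureTheory ProbabilityTheory
open scoped ContDiff ENNReal

/-- The second derivative `V''(x)` of `V` on `ℝⁿ`, as the linear operator (the Hessian matrix)
which is the derivative of the gradient field of `V` at `x`. -/
noncomputable def hessian {n : ℕ} (V : EuclideanSpace ℝ (Fin n) → ℝ)
    (x : EuclideanSpace ℝ (Fin n)) :
    EuclideanSpace ℝ (Fin n) →L[ℝ] EuclideanSpace ℝ (Fin n) :=
  fderiv ℝ (gradient V) x

/-- The measure concentrated on `Ω` with Lebesgue density `V ^ (-β)` there. -/
noncomputable def powerMeasure {n : ℕ} (Ω : Set (EuclideanSpace ℝ (Fin n)))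
    (V : EuclideanSpace ℝ (Fin n) → ℝ) (β : ℝ) : Measure (EuclideanSpace ℝ (Fin n)) :=
  (volume.restrict Ω).withDensity (fun x => ENNReal.ofReal (V x ^ (-β)))

/-- The weighted energy density `⟨V''(x)⁻¹ ∇G(x), ∇G(x)⟩ / V(x)`. (The inverse is the true inverse
operator wherever `V''(x)` is positive definite.) -/
noncomputable def energyDensity {n : ℕ} (V G : EuclideanSpace ℝ (Fin n) → ℝ)
    (x : EuclideanSpace ℝ (Fin n)) : ℝ :=
  inner ℝ ((hessian V x).inverse (gradient G x)) (gradient G x) / V x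

/-!
The inequality is the second-order infinitesimal form of a dimensional Prékopa–Leindler
inequality.

**The convexity behind it.** Let `φ_s = V + s G + s² H / 2` with `G = V g` and `H > ⟨V''⁻¹ ∇G,
∇G⟩`. If all functions are smooth, the Hessian of `(x, s) ↦ φ_s(x)` at `s = 0` is positive
definite, by the Schur complement, so near `s = 0` this function is jointly convex, and then `s ↦
(∫ φ_s ^ (-β)) ^ (-1 / (β - n))` is convex by the Borell–Brascamp–Lieb inequality. Writing `I` for
the integral of `φ_s ^ (-β)` and `κ = 1 / (β - n)`, non-negativity of the second derivative at `0`
says `I I'' ≤ (1 + κ) I' ^ 2`, where `I' = -β ∫ g dμ` and `I'' = β (β + 1) ∫ g² dμ - β ∫ H / V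
dμ`. Since `β (1 + κ) - (β + 1) = n / (β - n)`, this is the claim once `H` decreases to `⟨V''⁻¹
∇G, ∇G⟩`.

**Regularity.** Only midpoint convexity at `s = 0` is needed, that is `2 V ((x + y) / 2) ≤ φ_s(x)
+ φ_{-s}(y)` for small `s`, and it holds uniformly for `x`, `y` in a compact convex set `K ⊆ Ω`
(`eventually_two_mul_le_perturb`): off the diagonal by strict convexity of `V`, near the diagonal
by strict differentiability of `∇V` and coercivity of the block form
(`eventually_le_second_difference`, `exists_pos_mul_norm_sq_le_block`). So `H` need only be
continuous, and `G` continuously differentiable. On `K` everything is bounded and `I` can be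
differentiated twice under the integral sign (`second_variation_le`). The inequality on `K` for
the unnormalized restriction of the measure (`poincare_on_compact`) has no boundary terms, and it
passes to the limit `K ↑ Ω` by dominated convergence, with no cut-off of `g`.

**The Borell–Brascamp–Lieb inequality** for midpoints (`powMean_lintegral_le_pi`) is proved by
induction on the dimension. On the line it follows from the Brunn–Minkowski inequality for the
superlevel sets of the functions, rescaled to have supremum `1`, and Hölder's inequality
(`powMean_sub_one_le`). All functions there have values in `[0, ∞]`, where `rpow` with a negative
exponent exchanges `0` and `∞`; hence no positivity or integrability assumptions.
-/

/-! ### Power means on `[0, ∞]` -/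

lemma ENNReal.rpow_anti_of_nonpos {z : ℝ} (hz : z ≤ 0) {a b : ℝ≥0∞} (h : a ≤ b) :
    b ^ z ≤ a ^ z := by
  obtain ⟨y, rfl⟩ : ∃ y, z = -y := ⟨-z, by simp⟩
  rw [ENNReal.rpow_neg, ENNReal.rpow_neg, ENNReal.inv_le_inv]
  exact ENNReal.rpow_le_rpow h (by linarith)

lemma ENNReal.rpow_ne_zero_of_ne {c : ℝ≥0∞} (hc : c ≠ 0) (hc' : c ≠ ⊤) (z : ℝ) : c ^ z ≠ 0 := by
  rw [Ne, ENNReal.rpow_eq_zero_iff]; simp only [hc, hc']; simp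

lemma ENNReal.rpow_ne_top_of_ne {c : ℝ≥0∞} (hc : c ≠ 0) (hc' : c ≠ ⊤) (z : ℝ) : c ^ z ≠ ⊤ := by
  rw [Ne, ENNReal.rpow_eq_top_iff]; simp only [hc, hc']; simp

lemma ENNReal.mul_rpow_of_left {c : ℝ≥0∞} (hc : c ≠ 0) (hc' : c ≠ ⊤) (a : ℝ≥0∞) (z : ℝ) :
    (c * a) ^ z = c ^ z * a ^ z := by
  rcases le_total 0 z with hz | hz
  · exact ENNReal.mul_rpow_of_nonneg _ _ hz
  · obtain ⟨y, rfl⟩ : ∃ y, z = -y := ⟨-z, by simp⟩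
    have hy : 0 ≤ y := by linarith
    rw [ENNReal.rpow_neg, ENNReal.rpow_neg, ENNReal.rpow_neg, ENNReal.mul_rpow_of_nonneg _ _ hy,
      ENNReal.mul_inv]
    · exact .inl (ENNReal.rpow_ne_zero_of_ne hc hc' y)
    · exact .inl (ENNReal.rpow_ne_top_of_ne hc hc' y)

/-- The mean of order `-1/β` of two extended non-negative numbers. The conventions for `rpow` on
`ℝ≥0∞` make it vanish as soon as one of its arguments does. -/
noncomputable def powMean (β : ℝ) (a b : ℝ≥0∞) : ℝ≥0∞ :=
  ((a ^ (-1 / β) + b ^ (-1 / β)) / 2) ^ (-β)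

lemma powMean_mono {β : ℝ} (hβ : 0 < β) {a a' b b' : ℝ≥0∞} (ha : a ≤ a') (hb : b ≤ b') :
    powMean β a b ≤ powMean β a' b' := by
  have h : -1 / β ≤ 0 := div_nonpos_of_nonpos_of_nonneg (by norm_num) hβ.le
  unfold powMean
  apply ENNReal.rpow_anti_of_nonpos (by linarith)
  gcongr ?_ / 2
  exact add_le_add (ENNReal.rpow_anti_of_nonpos h ha) (ENNReal.rpow_anti_of_nonpos h hb)

lemma powMean_zero_left {β : ℝ} (hβ : 0 < β) (b : ℝ≥0∞) : powMean β 0 b = 0 := by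
  have h : -1 / β < 0 := div_neg_of_neg_of_pos (by norm_num) hβ
  simp [powMean, ENNReal.zero_rpow_of_neg h, ENNReal.top_rpow_of_neg (neg_lt_zero.2 hβ),
    ENNReal.top_div]

lemma powMean_zero_right {β : ℝ} (hβ : 0 < β) (a : ℝ≥0∞) : powMean β a 0 = 0 := by
  have h : -1 / β < 0 := div_neg_of_neg_of_pos (by norm_num) hβ
  simp [powMean, ENNReal.zero_rpow_of_neg h, ENNReal.top_rpow_of_neg (neg_lt_zero.2 hβ),
    ENNReal.top_div]

lemma continuous_powMean (β : ℝ) : Continuous fun p : ℝ≥0∞ × ℝ≥0∞ => powMean β p.1 p.2 := by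
  unfold powMean
  refine ENNReal.continuous_rpow_const.comp ?_
  refine (ENNReal.continuous_div_const 2 (by norm_num)).comp ?_
  exact (ENNReal.continuous_rpow_const.comp continuous_fst).add
    (ENNReal.continuous_rpow_const.comp continuous_snd)

lemma powMean_mul {β : ℝ} (hβ : 0 < β) {c : ℝ≥0∞} (hc : c ≠ 0) (hc' : c ≠ ⊤) (a b : ℝ≥0∞) :
    powMean β (c * a) (c * b) = c * powMean β a b := by
  have h0 := ENNReal.rpow_ne_zero_of_ne hc hc' (-1 / β)
  have h1 := ENNReal.rpow_ne_top_of_ne hc hc' (-1 / β)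
  unfold powMean
  rw [ENNReal.mul_rpow_of_left hc hc', ENNReal.mul_rpow_of_left hc hc', ← mul_add,
    mul_div_assoc, ENNReal.mul_rpow_of_left h0 h1, ← ENNReal.rpow_mul]
  rw [show -1 / β * -β = 1 by field_simp, ENNReal.rpow_one]

lemma powMean_ne_zero {β : ℝ} {a b : ℝ≥0∞} (ha : a ≠ 0) (ha' : a ≠ ⊤) (hb : b ≠ 0)
    (hb' : b ≠ ⊤) : powMean β a b ≠ 0 := by
  refine ENNReal.rpow_ne_zero_of_ne ?_ ?_ _
  · simp [ENNReal.rpow_ne_zero_of_ne ha ha']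
  · simp [ENNReal.div_eq_top, ENNReal.rpow_ne_top_of_ne ha ha', ENNReal.rpow_ne_top_of_ne hb hb']

lemma powMean_ne_top {β : ℝ} {a b : ℝ≥0∞} (ha : a ≠ 0) (ha' : a ≠ ⊤) (hb : b ≠ 0)
    (hb' : b ≠ ⊤) : powMean β a b ≠ ⊤ := by
  refine ENNReal.rpow_ne_top_of_ne ?_ ?_ _
  · simp [ENNReal.rpow_ne_zero_of_ne ha ha']
  · simp [ENNReal.div_eq_top, ENNReal.rpow_ne_top_of_ne ha ha', ENNReal.rpow_ne_top_of_ne hb hb']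

/-- Hölder's inequality for the exponents `β` and `β / (β - 1)`, in the form in which it lowers the
order of a power mean from `β` to `β - 1`. -/
lemma powMean_sub_one_le {β : ℝ} (hβ : 1 < β) {a b p q : ℝ≥0∞} (ha : a ≠ 0) (ha' : a ≠ ⊤)
    (hb : b ≠ 0) (hb' : b ≠ ⊤) (hp : p ≠ ⊤) (hq : q ≠ ⊤) :
    powMean (β - 1) (a * p) (b * q) ≤ powMean β a b * ((p + q) / 2) := by
  have hβ0 : 0 < β := by linarith
  have hγ : 0 < β - 1 := by linarith
  rcases eq_or_ne p 0 with rfl | hp0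
  · simp [powMean_zero_left hγ]
  rcases eq_or_ne q 0 with rfl | hq0
  · simp [powMean_zero_right hγ]
  have key : a ^ (-1 / β) + b ^ (-1 / β) ≤ (p + q) ^ (1 / β) *
      ((a * p) ^ (-1 / (β - 1)) + (b * q) ^ (-1 / (β - 1))) ^ ((β - 1) / β) := by
    have hpq : β.HolderConjugate (β / (β - 1)) := Real.HolderConjugate.conjExponent hβ
    have H := ENNReal.inner_le_Lp_mul_Lq Finset.univ ![p ^ (1 / β), q ^ (1 / β)]
      ![(a * p) ^ (-1 / β), (b * q) ^ (-1 / β)] hpq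
    simp only [Fin.sum_univ_two, Matrix.cons_val_zero, Matrix.cons_val_one,
      ← ENNReal.rpow_mul] at H
    have e1 : ∀ {x y : ℝ≥0∞}, x ≠ 0 → x ≠ ⊤ → y ≠ 0 → y ≠ ⊤ →
        y ^ (1 / β) * (x * y) ^ (-1 / β) = x ^ (-1 / β) := by
      intro x y hx hx' hy hy'
      rw [ENNReal.mul_rpow_of_ne_top hx' hy', mul_left_comm, ← ENNReal.rpow_add _ _ hy hy']
      rw [show 1 / β + -1 / β = 0 by ring]; simp
    rw [e1 ha ha' hp0 hp, e1 hb hb' hq0 hq, show 1 / β * β = 1 by field_simp,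
      show -1 / β * (β / (β - 1)) = -1 / (β - 1) by field_simp,
      show 1 / (β / (β - 1)) = (β - 1) / β by field_simp, ENNReal.rpow_one, ENNReal.rpow_one] at H
    exact H
  set S := (a * p) ^ (-1 / (β - 1)) + (b * q) ^ (-1 / (β - 1)) with hS
  have hP0 : (p + q) / 2 ≠ 0 := by simp [hp0]
  have hP1 : (p + q) / 2 ≠ ⊤ := by simp [ENNReal.div_eq_top, hp, hq]
  have key2 : (a ^ (-1 / β) + b ^ (-1 / β)) / 2 ≤
      ((p + q) / 2) ^ (1 / β) * (S / 2) ^ ((β - 1) / β) := by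
    have h2 : (2 : ℝ≥0∞)⁻¹ = (2⁻¹ : ℝ≥0∞) ^ (1 / β) * (2⁻¹ : ℝ≥0∞) ^ ((β - 1) / β) := by
      rw [← ENNReal.rpow_add _ _ (by simp) (by simp)]
      rw [show 1 / β + (β - 1) / β = 1 by field_simp; ring, ENNReal.rpow_one]
    have h3 : 0 ≤ 1 / β := by positivity
    have h4 : 0 ≤ (β - 1) / β := by positivity
    rw [ENNReal.div_eq_inv_mul, ENNReal.div_eq_inv_mul, ENNReal.div_eq_inv_mul,
      ENNReal.mul_rpow_of_nonneg _ _ h3,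
      ENNReal.mul_rpow_of_nonneg _ _ h4, mul_mul_mul_comm, ← h2]
    gcongr
  have key3 := ENNReal.rpow_anti_of_nonpos (neg_nonpos.2 hβ0.le) key2
  have hX0 := ENNReal.rpow_ne_zero_of_ne hP0 hP1 (1 / β)
  have hX1 := ENNReal.rpow_ne_top_of_ne hP0 hP1 (1 / β)
  rw [ENNReal.mul_rpow_of_left hX0 hX1, ← ENNReal.rpow_mul,
    ← ENNReal.rpow_mul, show 1 / β * -β = -1 by field_simp,
    show (β - 1) / β * -β = -(β - 1) by field_simp, ENNReal.rpow_neg_one] at key3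
  calc powMean (β - 1) (a * p) (b * q)
      = ((p + q) / 2)⁻¹ * (S / 2) ^ (-(β - 1)) * ((p + q) / 2) := by
        rw [mul_right_comm, ENNReal.inv_mul_cancel hP0 hP1, one_mul]; rfl
    _ ≤ powMean β a b * ((p + q) / 2) := by
        gcongr; exact key3

/-! ### The Borell–Brascamp–Lieb inequality for midpoints -/

/-- The Brunn–Minkowski inequality on the line, for midpoints. -/
lemma volume_add_volume_le_of_midpoint {A B C : Set ℝ} (hA : MeasurableSet A)
    (hB : MeasurableSet B) (hA0 : A.Nonempty) (hB0 : B.Nonempty)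
    (h : ∀ a ∈ A, ∀ b ∈ B, (a + b) / 2 ∈ C) : volume A + volume B ≤ 2 * volume C := by
  -- For compact sets the translates `K + min L` and `max K + L` lie in `K + L` and share one point.
  have comp : ∀ K L : Set ℝ, K ⊆ A → L ⊆ B → IsCompact K → IsCompact L → K.Nonempty → L.Nonempty →
      volume K + volume L ≤ 2 * volume C := by
    intro K L hK hL hKc hLc hK0 hL0
    obtain ⟨M, hM, hM'⟩ := hKc.exists_isGreatest hK0
    obtain ⟨m, hm, hm'⟩ := hLc.exists_isLeast hL0
    have hC : volume ((fun x : ℝ => 2⁻¹ * x) ⁻¹' C) = 2 * volume C := by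
      rw [Real.volume_preimage_mul_left (by norm_num)]; norm_num
    have h1 : volume ((fun x : ℝ => x + -m) ⁻¹' K) = volume K := measure_preimage_add_right _ _ _
    have h2 : volume ((fun x : ℝ => x + -M) ⁻¹' L) = volume L := measure_preimage_add_right _ _ _
    rw [← hC, ← h1, ← h2, ← measure_union₀]
    · refine measure_mono ?_
      rintro x (hx | hx)
      · have := h _ (hK hx) _ (hL hm)
        simpa [div_eq_inv_mul] using this
      · have := h _ (hK hM) _ (hL hx)
        simpa [div_eq_inv_mul] using this
    · exact ((measurable_id.add_const _) hLc.measurableSet).nullMeasurableSet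
    · refine measure_mono_null (t := {M + m}) ?_ (by simp)
      rintro x ⟨hx, hx'⟩
      have a1 := hM' hx
      have a2 := hm' hx'
      simp only [Set.mem_singleton_iff]
      linarith
  -- Nonempty compact subsets exhaust the measure of a nonempty measurable set.
  have sup : ∀ S : Set ℝ, MeasurableSet S → S.Nonempty →
      Nonempty {K : Set ℝ // K ⊆ S ∧ IsCompact K ∧ K.Nonempty} ∧
      volume S = ⨆ K : {K : Set ℝ // K ⊆ S ∧ IsCompact K ∧ K.Nonempty}, volume K.1 := by
    rintro S hS ⟨s, hs⟩
    refine ⟨⟨{s}, by simpa, isCompact_singleton, by simp⟩, le_antisymm ?_ ?_⟩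
    · refine le_of_forall_lt fun r hr => ?_
      obtain ⟨K, hKS, hK, hrK⟩ := hS.exists_lt_isCompact hr
      exact hrK.trans_le (le_iSup (fun K : {K : Set ℝ // K ⊆ S ∧ IsCompact K ∧ K.Nonempty} =>
        volume K.1) ⟨K, hKS, hK, nonempty_of_measure_ne_zero (ne_bot_of_gt hrK)⟩)
    · exact iSup_le fun K => measure_mono K.2.1
  obtain ⟨iA, eA⟩ := sup A hA hA0
  obtain ⟨iB, eB⟩ := sup B hB hB0
  rw [eA, eB, ENNReal.iSup_add]
  refine iSup_le fun K => ?_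
  rw [ENNReal.add_iSup]
  exact iSup_le fun L => comp K L K.2.1 L.2.1 K.2.2.1 L.2.2.1 K.2.2.2 L.2.2.2

/-- The function `w` dominates the `powMean β` of `u` and `v` at midpoints. -/
def MidpointDominates {E : Type*} [AddCommGroup E] [Module ℝ E] (β : ℝ) (u v w : E → ℝ≥0∞) :
    Prop :=
  ∀ x y, powMean β (u x) (v y) ≤ w ((2⁻¹ : ℝ) • (x + y))

lemma powMean_lintegral_le_of_bounded {β : ℝ} (hβ : 1 < β) {u v w : ℝ → ℝ≥0∞} (hu : Measurable u)
    (hv : Measurable v) (hw : Measurable w) (h : MidpointDominates β u v w) {C : ℝ≥0∞}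
    (hC : C ≠ ⊤) (huC : ∀ x, u x ≤ C) (hvC : ∀ x, v x ≤ C) (hu' : ∫⁻ x, u x ≠ ⊤)
    (hv' : ∫⁻ x, v x ≠ ⊤) :
    powMean (β - 1) (∫⁻ x, u x) (∫⁻ x, v x) ≤ ∫⁻ x, w x := by
  have hβ0 : 0 < β := by linarith
  have hγ : 0 < β - 1 := by linarith
  set A := ⨆ x, u x with hA
  set B := ⨆ x, v x with hB
  have hA' : A ≠ ⊤ := ne_top_of_le_ne_top hC (iSup_le huC)
  have hB' : B ≠ ⊤ := ne_top_of_le_ne_top hC (iSup_le hvC)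
  rcases eq_or_ne A 0 with hA0 | hA0
  · have : ∀ x, u x = 0 := by simpa [hA] using hA0
    simp [this, powMean_zero_left hγ]
  rcases eq_or_ne B 0 with hB0 | hB0
  · have : ∀ x, v x = 0 := by simpa [hB] using hB0
    simp [this, powMean_zero_right hγ]
  set M := powMean β A B with hM
  have hM0 : M ≠ 0 := powMean_ne_zero hA0 hA' hB0 hB'
  have hM1 : M ≠ ⊤ := powMean_ne_top hA0 hA' hB0 hB'
  -- After rescaling, all superlevel sets of interest have levels in `(0, 1)`.
  have layer : ∀ f : ℝ → ℝ≥0∞, Measurable f → (∀ x, f x ≤ 1) →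
      ∫⁻ x, f x = ∫⁻ t in Set.Ioi (0 : ℝ), volume {x | t < (f x).toReal} := by
    intro f hf hf1
    rw [← lintegral_eq_lintegral_meas_lt volume (.of_forall fun _ => ENNReal.toReal_nonneg)
      hf.ennreal_toReal.aemeasurable]
    exact lintegral_congr fun x =>
      (ENNReal.ofReal_toReal (ne_top_of_le_ne_top ENNReal.one_ne_top (hf1 x))).symm
  have hu1 : ∀ x, u x / A ≤ 1 := fun x => ENNReal.div_le_of_le_mul (by simpa using le_iSup u x)
  have hv1 : ∀ x, v x / B ≤ 1 := fun x => ENNReal.div_le_of_le_mul (by simpa using le_iSup v x)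
  have lev : ∀ t : ℝ, 0 < t →
      volume {x | t < (u x / A).toReal} + volume {x | t < (v x / B).toReal} ≤
      2 * volume {x | t < (min (w x / M) 1).toReal} := by
    intro t ht
    rcases le_or_gt 1 t with ht1 | ht1
    · have key : ∀ a : ℝ≥0∞, a ≤ 1 → ¬ t < a.toReal := fun a ha =>
        not_lt.2 ((ENNReal.toReal_mono ENNReal.one_ne_top ha).trans (by simpa using ht1))
      simp only [key _ (hu1 _), key _ (hv1 _)]
      simp
    have conv : ∀ a : ℝ≥0∞, a ≤ 1 → (t < a.toReal ↔ ENNReal.ofReal t < a) := fun a ha =>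
      (ENNReal.ofReal_lt_iff_lt_toReal ht.le (ne_top_of_le_ne_top ENNReal.one_ne_top ha)).symm
    have nonempty : ∀ (f : ℝ → ℝ≥0∞), (⨆ x, f x) ≠ 0 → (⨆ x, f x) ≠ ⊤ →
        ∃ x, ENNReal.ofReal t < f x / ⨆ x, f x := by
      intro f hf0 hf1
      have : ENNReal.ofReal t * (⨆ x, f x) < ⨆ x, f x := by
        conv_rhs => rw [← one_mul (⨆ x, f x)]
        exact ENNReal.mul_lt_mul_left hf0 hf1 (by simpa using ht1)
      obtain ⟨x, hx⟩ := lt_iSup_iff.1 this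
      exact ⟨x, (ENNReal.lt_div_iff_mul_lt (.inl hf0) (.inl hf1)).2 hx⟩
    refine volume_add_volume_le_of_midpoint ?_ ?_ ?_ ?_ ?_
    · exact measurableSet_lt measurable_const (hu.div_const A).ennreal_toReal
    · exact measurableSet_lt measurable_const (hv.div_const B).ennreal_toReal
    · obtain ⟨x, hx⟩ := nonempty u hA0 hA'
      exact ⟨x, (conv _ (hu1 x)).2 hx⟩
    · obtain ⟨x, hx⟩ := nonempty v hB0 hB'
      exact ⟨x, (conv _ (hv1 x)).2 hx⟩
    · intro x hx y hy
      have hx2 := (conv _ (hu1 x)).1 hx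
      have hy2 := (conv _ (hv1 y)).1 hy
      refine (conv _ (min_le_right _ _)).2 (lt_min ?_ (by simpa using ht1))
      set c := min (u x / A) (v y / B) with hc
      have hct : ENNReal.ofReal t < c := lt_min hx2 hy2
      have hc0 : c ≠ 0 := ne_bot_of_gt hct
      have hc1 : c ≠ ⊤ := ne_top_of_le_ne_top ENNReal.one_ne_top ((min_le_left _ _).trans (hu1 x))
      refine hct.trans_le ?_
      rw [ENNReal.le_div_iff_mul_le (.inl hM0) (.inl hM1), hM, ← powMean_mul hβ0 hc0 hc1]
      have e := h x y
      rw [show (2⁻¹ : ℝ) • (x + y) = (x + y) / 2 by simp [div_eq_inv_mul]] at e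
      refine (powMean_mono hβ0 ?_ ?_).trans e
      · exact (ENNReal.le_div_iff_mul_le (.inl hA0) (.inl hA')).1 (min_le_left _ _)
      · exact (ENNReal.le_div_iff_mul_le (.inl hB0) (.inl hB')).1 (min_le_right _ _)
  have sum : (∫⁻ x, u x / A) + ∫⁻ x, v x / B ≤ 2 * ∫⁻ x, w x / M := by
    calc _ ≤ 2 * ∫⁻ x, min (w x / M) 1 := by
          rw [layer _ (hu.div_const A) hu1, layer _ (hv.div_const B) hv1,
            layer _ ((hw.div_const M).min measurable_const) fun _ => min_le_right _ _,
            ← lintegral_const_mul' _ _ (by simp)]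
          refine (le_lintegral_add _ _).trans ?_
          exact setLIntegral_mono' measurableSet_Ioi lev
      _ ≤ _ := by gcongr; exact min_le_left _ _
  have eq : ∀ (f : ℝ → ℝ≥0∞) (a : ℝ≥0∞), a ≠ 0 → ∫⁻ x, f x / a = (∫⁻ x, f x) / a := by
    intro f a ha
    simp only [div_eq_mul_inv]
    exact lintegral_mul_const' _ _ (by simpa using ha)
  rw [eq _ _ hA0, eq _ _ hB0, eq _ _ hM0] at sum
  have H := powMean_sub_one_le hβ hA0 hA' hB0 hB' (ENNReal.div_ne_top hu' hA0)
    (ENNReal.div_ne_top hv' hB0)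
  rw [ENNReal.mul_div_cancel hA0 hA', ENNReal.mul_div_cancel hB0 hB'] at H
  refine H.trans ?_
  calc M * (((∫⁻ x, u x) / A + (∫⁻ x, v x) / B) / 2)
      ≤ M * ((∫⁻ x, w x) / M) := by
        exact mul_le_mul' le_rfl (ENNReal.div_le_of_le_mul (sum.trans_eq (mul_comm _ _)))
    _ = ∫⁻ x, w x := ENNReal.mul_div_cancel hM0 hM1

/-- The Borell–Brascamp–Lieb inequality on the line. -/
lemma powMean_lintegral_le_real {β : ℝ} (hβ : 1 < β) {u v w : ℝ → ℝ≥0∞} (hu : Measurable u)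
    (hv : Measurable v) (hw : Measurable w) (h : MidpointDominates β u v w) :
    powMean (β - 1) (∫⁻ x, u x) (∫⁻ x, v x) ≤ ∫⁻ x, w x := by
  let T : (ℝ → ℝ≥0∞) → ℕ → ℝ → ℝ≥0∞ := fun f N =>
    (Set.Icc (-(N : ℝ)) N).indicator fun x => min (f x) N
  have Tm : ∀ f N, Measurable f → Measurable (T f N) := fun f N hf =>
    (hf.min measurable_const).indicator measurableSet_Icc
  have Tle : ∀ f N x, T f N x ≤ f x := fun f N x =>
    Set.indicator_apply_le' (fun _ => min_le_left _ _) fun _ => zero_le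
  have TleN : ∀ f N x, T f N x ≤ N := fun f N x =>
    Set.indicator_apply_le' (fun _ => min_le_right _ _) fun _ => zero_le
  have Tfin : ∀ f N, ∫⁻ x, T f N x ≠ ⊤ := by
    intro f N
    rw [lintegral_indicator measurableSet_Icc]
    refine ne_top_of_le_ne_top ?_ (setLIntegral_mono' (g := fun _ => (N : ℝ≥0∞)) measurableSet_Icc
      fun x _ => min_le_right _ _)
    simp [ENNReal.mul_eq_top]
  have Tlim : ∀ f, Measurable f →
      Filter.Tendsto (fun N => ∫⁻ x, T f N x) Filter.atTop (nhds (∫⁻ x, f x)) := by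
    intro f hf
    refine lintegral_tendsto_of_tendsto_of_monotone (fun N => (Tm f N hf).aemeasurable)
      (.of_forall fun x => ?_) (.of_forall fun x => ?_)
    · intro N N' hN
      have hN' : (N : ℝ) ≤ N' := by exact_mod_cast hN
      have hN'' : (N : ℝ≥0∞) ≤ N' := by exact_mod_cast hN
      refine (Set.indicator_le_indicator (f := fun x => min (f x) (N : ℝ≥0∞))
        (g := fun x => min (f x) (N' : ℝ≥0∞)) (min_le_min le_rfl hN'')).trans ?_
      exact Set.indicator_le_indicator_of_subset
        (Set.Icc_subset_Icc (neg_le_neg hN') hN') (fun _ => zero_le) _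
    · have e : ∀ᶠ N : ℕ in Filter.atTop, min (f x) N = T f N x := by
        filter_upwards [Filter.eventually_ge_atTop ⌈|x|⌉₊] with N hN
        have := abs_le.1 (Nat.ceil_le.1 hN)
        exact (Set.indicator_of_mem (Set.mem_Icc.2 this) fun x => min (f x) (N : ℝ≥0∞)).symm
      refine Filter.Tendsto.congr' e ?_
      have := (tendsto_const_nhds (x := f x)).min ENNReal.tendsto_nat_nhds_top
      simpa using this
  refine le_of_tendsto (((continuous_powMean (β - 1)).tendsto _).comp
    ((Tlim u hu).prodMk_nhds (Tlim v hv))) (.of_forall fun N => ?_)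
  refine powMean_lintegral_le_of_bounded hβ (Tm u N hu) (Tm v N hv) hw ?_
    (ENNReal.natCast_ne_top N) (TleN u N) (TleN v N) (Tfin u N) (Tfin v N)
  exact fun x y => (powMean_mono (by linarith) (Tle u N x) (Tle v N y)).trans (h x y)

/-- The Borell–Brascamp–Lieb inequality on `ℝⁿ`: the integrals over the fibres of the first
coordinate again satisfy the hypothesis, with `β` lowered by the dimension of the fibre. -/
lemma powMean_lintegral_le_pi (n : ℕ) {β : ℝ} (hβ : n < β) {u v w : (Fin n → ℝ) → ℝ≥0∞}
    (hu : Measurable u) (hv : Measurable v) (hw : Measurable w) (h : MidpointDominates β u v w) :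
    powMean (β - n) (∫⁻ x, u x) (∫⁻ x, v x) ≤ ∫⁻ x, w x := by
  induction n generalizing β with
  | zero =>
    simp only [lintegral_unique, Measure.volume_pi_eq_dirac 0]
    simp only [measure_univ, mul_one, Nat.cast_zero, sub_zero]
    convert h default default
  | succ n ih =>
    push_cast at hβ
    let e := MeasurableEquiv.piFinSuccAbove (fun _ : Fin (n + 1) => ℝ) 0
    have he : MeasurePreserving e.symm :=
      (volume_preserving_piFinSuccAbove (fun _ : Fin (n + 1) => ℝ) 0).symm
    have hes : ∀ a b x y, (2⁻¹ : ℝ) • (e.symm (a, x) + e.symm (b, y)) =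
        e.symm ((2⁻¹ : ℝ) • (a + b), (2⁻¹ : ℝ) • (x + y)) := by
      intro a b x y
      ext i
      refine Fin.cases ?_ (fun j => ?_) i <;> 
        simp [e, MeasurableEquiv.piFinSuccAbove, mul_add]
    have split : ∀ f : (Fin (n + 1) → ℝ) → ℝ≥0∞, Measurable f →
        ∫⁻ x, f x = ∫⁻ a : ℝ, ∫⁻ x, f (e.symm (a, x)) := by
      intro f hf
      rw [← he.lintegral_comp hf, Measure.volume_eq_prod,
        lintegral_prod (fun z => f (e.symm z)) (hf.comp e.symm.measurable).aemeasurable]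
    have slice : ∀ f : (Fin (n + 1) → ℝ) → ℝ≥0∞, Measurable f → ∀ a,
        Measurable fun x => f (e.symm (a, x)) := fun f hf a =>
      hf.comp (e.symm.measurable.comp measurable_prodMk_left)
    have marg : ∀ f : (Fin (n + 1) → ℝ) → ℝ≥0∞, Measurable f →
        Measurable fun a => ∫⁻ x, f (e.symm (a, x)) := fun f hf =>
      (hf.comp e.symm.measurable).lintegral_prod_right'
    rw [split u hu, split v hv, split w hw]
    have := powMean_lintegral_le_real (β := β - n) (by linarith) (marg u hu) (marg v hv) (marg w hw)
      fun a b => ih (by linarith) (slice u hu a) (slice v hv b) (slice w hw _) fun x y => by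
        rw [← hes]; exact h _ _
    convert this using 2
    push_cast; ring

lemma powMean_lintegral_le (n : ℕ) {β : ℝ} (hβ : n < β) {u v w : EuclideanSpace ℝ (Fin n) → ℝ≥0∞}
    (hu : Measurable u) (hv : Measurable v) (hw : Measurable w) (h : MidpointDominates β u v w) :
    powMean (β - n) (∫⁻ x, u x) (∫⁻ x, v x) ≤ ∫⁻ x, w x := by
  have he := PiLp.volume_preserving_toLp (Fin n)
  rw [← he.lintegral_comp hu, ← he.lintegral_comp hv, ← he.lintegral_comp hw]
  refine powMean_lintegral_le_pi n hβ (hu.comp he.measurable) (hv.comp he.measurable)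
    (hw.comp he.measurable) fun x y => ?_
  simpa using h (WithLp.toLp 2 x) (WithLp.toLp 2 y)

/-! ### Gradient and Hessian -/

section Gradient

variable {E : Type*} [NormedAddCommGroup E] [InnerProductSpace ℝ E] [CompleteSpace E]

lemma ContDiffOn.contDiffOn_gradient {V : E → ℝ} {Ω : Set E} (hΩ : IsOpen Ω)
    (hV : ContDiffOn ℝ 2 V Ω) : ContDiffOn ℝ 1 (gradient V) Ω :=
  (InnerProductSpace.toDual ℝ E).symm.contDiff.comp_contDiffOn
    (hV.fderiv_of_isOpen hΩ (by norm_num))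

lemma ContDiffAt.contDiffAt_gradient {V : E → ℝ} {x : E} (hV : ContDiffAt ℝ 2 V x) :
    ContDiffAt ℝ 1 (gradient V) x :=
  (InnerProductSpace.toDual ℝ E).symm.contDiff.contDiffAt.comp x
    (hV.fderiv_right (m := 1) (by norm_num))

lemma ContDiffOn.continuousOn_gradient {V : E → ℝ} {Ω : Set E} (hΩ : IsOpen Ω)
    (hV : ContDiffOn ℝ 1 V Ω) : ContinuousOn (gradient V) Ω :=
  (InnerProductSpace.toDual ℝ E).symm.continuous.comp_continuousOn
    (hV.continuousOn_fderiv_of_isOpen hΩ (by norm_num))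

lemma inner_fderiv_gradient {V : E → ℝ} {x : E} (hV : ContDiffAt ℝ 2 V x) (u v : E) :
    inner ℝ (fderiv ℝ (gradient V) x u) v = fderiv ℝ (fderiv ℝ V) x u v := by
  have h : DifferentiableAt ℝ (fderiv ℝ V) x :=
    (hV.fderiv_right (m := 1) (by norm_num)).differentiableAt (by norm_num)
  have hg : DifferentiableAt ℝ (gradient V) x :=
    (hV.contDiffAt_gradient).differentiableAt (by norm_num)
  have e : (fun y => inner ℝ (gradient V y) v) = fun y => fderiv ℝ V y v :=
    funext fun y => inner_gradient_left
  have h1 := hg.hasFDerivAt.inner ℝ (hasFDerivAt_const v x)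
  have h2 := h.hasFDerivAt.clm_apply (hasFDerivAt_const v x)
  rw [← e] at h2
  simpa using congrArg (fun L => L u) (h1.unique h2)

lemma inner_fderiv_gradient_comm {V : E → ℝ} {x : E} (hV : ContDiffAt ℝ 2 V x) (u v : E) :
    inner ℝ (fderiv ℝ (gradient V) x u) v = inner ℝ (fderiv ℝ (gradient V) x v) u := by
  rw [inner_fderiv_gradient hV, inner_fderiv_gradient hV]
  exact (hV.isSymmSndFDerivAt (by simp)).eq u v

/-- Second differences of `V` near a point are bounded below by its Hessian form there, uniformly in
the base point: the derivative of `t ↦ V (z + t • d) + V (z - t • d)` is controlled by strict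
differentiability of the gradient. -/
lemma eventually_le_second_difference {V : E → ℝ} {x₀ : E} {A : E →L[ℝ] E}
    (hV : ∀ᶠ x in nhds x₀, HasGradientAt V (gradient V x) x)
    (hA : HasStrictFDerivAt (gradient V) A x₀) {η : ℝ} (hη : 0 < η) :
    ∀ᶠ p : E × E in nhds (x₀, x₀),
      inner ℝ (A ((2⁻¹ : ℝ) • (p.1 - p.2))) ((2⁻¹ : ℝ) • (p.1 - p.2)) -
        η * ‖(2⁻¹ : ℝ) • (p.1 - p.2)‖ ^ 2 ≤
      V p.1 + V p.2 - 2 * V ((2⁻¹ : ℝ) • (p.1 + p.2)) := by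
  have h1 := (hasStrictFDerivAt_iff_isLittleO.1 hA).bound hη
  obtain ⟨r, hr, H⟩ := Metric.eventually_nhds_iff_ball.1 (h1.and (hV.prodMk_nhds hV))
  refine Metric.eventually_nhds_iff_ball.2 ⟨r, hr, ?_⟩
  rintro ⟨x, y⟩ hxy
  have hxy' : x ∈ Metric.ball x₀ r ∧ y ∈ Metric.ball x₀ r := by
    simpa [← ball_prod_same] using hxy
  set d := (2⁻¹ : ℝ) • (x - y) with hd
  set z := (2⁻¹ : ℝ) • (x + y) with hz
  set a := inner ℝ (A d) d - η * ‖d‖ ^ 2 with ha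
  have mem : ∀ t ∈ Set.Icc (-1 : ℝ) 1, z + t • d ∈ Metric.ball x₀ r := by
    intro t ht
    have : z + t • d = ((1 + t) / 2) • x + ((1 - t) / 2) • y := by rw [hz, hd]; module
    rw [this]
    exact convex_ball x₀ r hxy'.1 hxy'.2 (by linarith [ht.1]) (by linarith [ht.2]) (by ring)
  have bd : ∀ t ∈ Set.Icc (0 : ℝ) 1, 2 * t * a ≤
      inner ℝ (gradient V (z + t • d) - gradient V (z + (-t) • d)) d := by
    intro t ht
    have m1 := mem t ⟨by linarith [ht.1], ht.2⟩
    have m2 := mem (-t) ⟨by linarith [ht.2], by linarith [ht.1]⟩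
    have h := (H (z + t • d, z + (-t) • d) (by rw [← ball_prod_same]; exact ⟨m1, m2⟩)).1
    have e : z + t • d - (z + (-t) • d) = (2 * t) • d := by module
    simp only [e, map_smul] at h
    rw [norm_smul, Real.norm_eq_abs, abs_of_nonneg (by linarith [ht.1])] at h
    have h2 := (abs_le.1 (abs_real_inner_le_norm (gradient V (z + t • d) -
      gradient V (z + (-t) • d) - (2 * t) • A d) d)).1
    rw [inner_sub_left, inner_smul_left] at h2
    simp only [conj_trivial] at h2
    have h3 := mul_le_mul_of_nonneg_right h (norm_nonneg d)
    rw [ha]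
    nlinarith
  have line : ∀ s : ℝ, ∀ t, HasDerivAt (fun t : ℝ => z + (s * t) • d) (s • d) t := by
    intro s t
    simpa using (((hasDerivAt_id t).const_mul s).smul_const d).const_add z
  have der : ∀ t ∈ Set.Icc (0 : ℝ) 1, HasDerivAt
      (fun t : ℝ => V (z + (1 * t) • d) + V (z + (-1 * t) • d) - t ^ 2 * a)
      (inner ℝ (gradient V (z + t • d) - gradient V (z + (-t) • d)) d - 2 * t * a) t := by
    intro t ht
    have m1 := mem t ⟨by linarith [ht.1], ht.2⟩
    have m2 := mem (-t) ⟨by linarith [ht.2], by linarith [ht.1]⟩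
    have h := (H (z + t • d, z + (-t) • d) (by rw [← ball_prod_same]; exact ⟨m1, m2⟩)).2
    have d1 := HasFDerivAt.comp_hasDerivAt_of_eq t h.1.hasFDerivAt (line 1 t) (by simp)
    have d2 := HasFDerivAt.comp_hasDerivAt_of_eq t h.2.hasFDerivAt (line (-1) t) (by simp)
    refine ((d1.add d2).sub ((hasDerivAt_pow 2 t).mul_const a)).congr_deriv ?_
    simp [inner_sub_left]
    ring
  have mono := monotoneOn_of_deriv_nonneg (convex_Icc (0 : ℝ) 1)
    (fun t ht => (der t ht).continuousAt.continuousWithinAt)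
    (fun t ht => (der t (interior_subset ht)).differentiableAt.differentiableWithinAt)
    (fun t ht => by
      rw [(der t (interior_subset ht)).deriv]
      linarith [bd t (interior_subset ht)])
  have fin := mono (Set.left_mem_Icc.2 zero_le_one) (Set.right_mem_Icc.2 zero_le_one) zero_le_one
  have e1 : z + (1 * 1 : ℝ) • d = x := by rw [hz, hd]; module
  have e2 : z + (-1 * 1 : ℝ) • d = y := by rw [hz, hd]; module
  simp only [e1, e2, mul_zero, zero_smul, add_zero] at fin
  linarith

/-- A positive 2-homogeneous function on a finite-dimensional space is bounded below by a multiple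
of the squared norm. -/
lemma exists_pos_mul_norm_sq_le {F : Type*} [NormedAddCommGroup F] [NormedSpace ℝ F]
    [FiniteDimensional ℝ F] {q : F → ℝ} (hq : Continuous q)
    (hq2 : ∀ (t : ℝ) x, q (t • x) = t ^ 2 * q x) (hpos : ∀ x, x ≠ 0 → 0 < q x) :
    ∃ c > 0, ∀ x, c * ‖x‖ ^ 2 ≤ q x := by
  have h0 : q 0 = 0 := by simpa using hq2 0 0
  rcases subsingleton_or_nontrivial F with hF | hF
  · exact ⟨1, one_pos, fun x => by simp [Subsingleton.elim x 0, h0]⟩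
  have : ProperSpace F := FiniteDimensional.proper_real F
  obtain ⟨y, hy, hmin⟩ := (isCompact_sphere (0 : F) 1).exists_isMinOn
    (NormedSpace.sphere_nonempty.2 zero_le_one) hq.continuousOn
  have hy0 : y ≠ 0 := by rintro rfl; simp at hy
  refine ⟨q y, hpos y hy0, fun x => ?_⟩
  rcases eq_or_ne x 0 with rfl | hx
  · simp [h0]
  have hx' : ‖x‖ ≠ 0 := norm_ne_zero_iff.2 hx
  have h := hmin (a := ‖x‖⁻¹ • x) (by simp [norm_smul, hx'])
  have h' : q y ≤ q (‖x‖⁻¹ • x) := h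
  rwa [hq2, inv_pow, ← div_eq_inv_mul, le_div_iff₀ (by positivity)] at h'

end Gradient

section Operator

variable {E : Type*} [NormedAddCommGroup E] [InnerProductSpace ℝ E] [FiniteDimensional ℝ E]

lemma exists_equiv_of_inner_pos {A : E →L[ℝ] E} (hA : ∀ h, h ≠ 0 → 0 < inner ℝ (A h) h) :
    ∃ e : E ≃L[ℝ] E, (e : E →L[ℝ] E) = A := by
  have inj : Function.Injective (A : E →ₗ[ℝ] E) := by
    rw [injective_iff_map_eq_zero]
    intro a ha
    by_contra h
    have := hA a h
    have ha' : A a = 0 := ha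
    simp [ha'] at this
  exact ⟨(LinearEquiv.ofInjectiveEndo (A : E →ₗ[ℝ] E) inj).toContinuousLinearEquiv, by ext; rfl⟩

/-- The block form `⟨A d, d⟩ + 2 s ⟨b, d⟩ + s² h` is coercive once `h` exceeds `⟨A⁻¹ b, b⟩`: its
Schur complement is then positive. -/
lemma exists_pos_mul_norm_sq_le_block {A : E →L[ℝ] E} (hA : ∀ h, h ≠ 0 → 0 < inner ℝ (A h) h)
    (hsymm : ∀ u v, inner ℝ (A u) v = inner ℝ (A v) u) {b : E} {h : ℝ}
    (hh : inner ℝ (A.inverse b) b < h) :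
    ∃ c > 0, ∀ (d : E) (s : ℝ), c * (‖d‖ ^ 2 + s ^ 2) ≤
      inner ℝ (A d) d + 2 * s * inner ℝ b d + s ^ 2 * h := by
  obtain ⟨e, rfl⟩ := exists_equiv_of_inner_pos hA
  rw [ContinuousLinearMap.inverse_equiv] at hh
  simp only [ContinuousLinearEquiv.coe_coe] at *
  obtain ⟨c, hc, H⟩ := exists_pos_mul_norm_sq_le (F := E × ℝ)
    (q := fun p => inner ℝ (e p.1) p.1 + 2 * p.2 * inner ℝ b p.1 + p.2 ^ 2 * h) (by fun_prop)
    (fun t p => by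
      simp only [Prod.smul_fst, Prod.smul_snd, map_smul, inner_smul_left, inner_smul_right,
        smul_eq_mul, conj_trivial]
      ring)
    (fun p hp => by
      have hA' : ∀ u, 0 ≤ inner ℝ (e u) u := fun u => by
        rcases eq_or_ne u 0 with rfl | hu
        · simp
        · exact (hA u hu).le
      have key : inner ℝ (e p.1) p.1 + 2 * p.2 * inner ℝ b p.1 + p.2 ^ 2 * h =
          inner ℝ (e (p.1 + p.2 • e.symm b)) (p.1 + p.2 • e.symm b) +
            p.2 ^ 2 * (h - inner ℝ (e.symm b) b) := by
        have e1 := hsymm p.1 (e.symm b)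
        simp only [ContinuousLinearEquiv.apply_symm_apply] at e1
        simp only [map_add, map_smul, inner_add_left, inner_add_right, inner_smul_left,
          inner_smul_right, ContinuousLinearEquiv.apply_symm_apply, conj_trivial, e1,
          real_inner_comm b (e.symm b)]
        ring
      rw [key]
      rcases eq_or_ne p.2 0 with h2 | h2
      · have h1 : p.1 ≠ 0 := fun h1 => hp (Prod.ext h1 h2)
        simpa [h2] using hA _ h1
      · have := hA' (p.1 + p.2 • e.symm b)
        have h3 : 0 < p.2 ^ 2 * (h - inner ℝ (e.symm b) b) :=
          mul_pos (by positivity) (by linarith)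
        linarith)
  refine ⟨c / 2, by positivity, fun d s => (le_trans ?_ (H (d, s)))⟩
  have h1 : ‖d‖ ≤ ‖(d, s)‖ := norm_fst_le (d, s)
  have h2 : |s| ≤ ‖(d, s)‖ := norm_snd_le (d, s)
  have h1' : ‖d‖ ^ 2 ≤ ‖(d, s)‖ ^ 2 := by gcongr
  have h2' : s ^ 2 ≤ ‖(d, s)‖ ^ 2 := by rw [← sq_abs]; gcongr
  nlinarith

end Operator

/-! ### Midpoint convexity of the perturbed potential -/

/-- The perturbation `V + s G + s² H / 2` of the potential `V`. -/
noncomputable def perturb {E : Type*} (V G H : E → ℝ) (s : ℝ) (x : E) : ℝ :=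
  V x + s * G x + s ^ 2 / 2 * H x

section Perturb

variable {E : Type*} [NormedAddCommGroup E] [InnerProductSpace ℝ E] [FiniteDimensional ℝ E]

lemma eventually_hasGradientAt {V : E → ℝ} {Ω : Set E} (hΩ : IsOpen Ω) (hV : ContDiffOn ℝ 1 V Ω)
    {x : E} (hx : x ∈ Ω) : ∀ᶠ y in nhds x, HasGradientAt V (gradient V y) y := by
  filter_upwards [hΩ.mem_nhds hx] with y hy
  exact ((hV.contDiffAt (hΩ.mem_nhds hy)).differentiableAt (by norm_num)).hasGradientAt

lemma hasStrictFDerivAt_gradient {V : E → ℝ} {x : E} (hV : ContDiffAt ℝ 2 V x) :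
    HasStrictFDerivAt (gradient V) (fderiv ℝ (gradient V) x) x :=
  hV.contDiffAt_gradient.hasStrictFDerivAt (by norm_num)

/-- A convex function with positive definite Hessian is strictly convex at midpoints. -/
lemma two_mul_lt_of_hessian_pos {V : E → ℝ} {Ω : Set E} (hΩ : IsOpen Ω) (hV : ContDiffOn ℝ 2 V Ω)
    (hconv : ConvexOn ℝ Ω V)
    (hpos : ∀ x ∈ Ω, ∀ h : E, h ≠ 0 → 0 < inner ℝ (fderiv ℝ (gradient V) x h) h)
    {x y : E} (hx : x ∈ Ω) (hy : y ∈ Ω) (hxy : x ≠ y) :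
    2 * V ((2⁻¹ : ℝ) • (x + y)) < V x + V y := by
  set z := (2⁻¹ : ℝ) • (x + y) with hz
  set d := (2⁻¹ : ℝ) • (x - y) with hd
  have hzΩ : z ∈ Ω := by
    rw [hz, smul_add]
    exact hconv.1 hx hy (by norm_num) (by norm_num) (by norm_num)
  have hd0 : d ≠ 0 := by simpa [hd, sub_eq_zero] using hxy
  have hd' : 0 < ‖d‖ ^ 2 := by positivity
  have hA := hpos z hzΩ d hd0
  set a := inner ℝ (fderiv ℝ (gradient V) z d) d with ha
  have ev := eventually_le_second_difference
    (eventually_hasGradientAt hΩ (hV.of_le (by norm_num)) hzΩ)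
    (hasStrictFDerivAt_gradient (hV.contDiffAt (hΩ.mem_nhds hzΩ)))
    (η := a / (2 * ‖d‖ ^ 2)) (by positivity)
  have lim : Filter.Tendsto (fun t : ℝ => (z + t • d, z - t • d)) (nhdsWithin 0 (Set.Ioi 0))
      (nhds (z, z)) := by
    have : Continuous fun t : ℝ => (z + t • d, z - t • d) := by fun_prop
    simpa using (this.tendsto 0).mono_left nhdsWithin_le_nhds
  obtain ⟨t, ⟨ht, ht1⟩, ht0⟩ := (((lim.eventually ev).and
    (nhdsWithin_le_nhds (Iio_mem_nhds one_pos))).and self_mem_nhdsWithin).exists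
  have ht0 : 0 < t := ht0
  have ht1 : t < 1 := ht1
  have e1 : (2⁻¹ : ℝ) • (z + t • d - (z - t • d)) = t • d := by module
  have e2 : (2⁻¹ : ℝ) • (z + t • d + (z - t • d)) = z := by module
  simp only [e1, e2, map_smul, inner_smul_left, inner_smul_right, conj_trivial, norm_smul,
    mul_pow, Real.norm_eq_abs, sq_abs, ← ha] at ht
  have e3 : a / (2 * ‖d‖ ^ 2) * (t ^ 2 * ‖d‖ ^ 2) = t ^ 2 * a / 2 := by field_simp
  rw [e3] at ht
  have c1 := hconv.2 hzΩ hx (sub_nonneg.2 ht1.le) ht0.le (by ring)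
  have c2 := hconv.2 hzΩ hy (sub_nonneg.2 ht1.le) ht0.le (by ring)
  have f1 : (1 - t) • z + t • x = z + t • d := by rw [hz, hd]; module
  have f2 : (1 - t) • z + t • y = z - t • d := by rw [hz, hd]; module
  simp only [f1, f2, smul_eq_mul] at c1 c2
  have : 0 < t ^ 2 * a := by positivity
  nlinarith

/-- Where `H` exceeds `⟨V''⁻¹ ∇G, ∇G⟩`, small perturbations of opposite sign have midpoint means
above `V`, locally uniformly near the diagonal. -/
lemma eventually_two_mul_le_perturb_diag {V G H : E → ℝ} {x₀ : E} (hV : ContDiffAt ℝ 2 V x₀)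
    (hVg : ∀ᶠ y in nhds x₀, HasGradientAt V (gradient V y) y)
    (hG : ContDiffAt ℝ 1 G x₀) (hH : ContinuousAt H x₀)
    (hpos : ∀ h : E, h ≠ 0 → 0 < inner ℝ (fderiv ℝ (gradient V) x₀ h) h)
    (hlt : inner ℝ ((fderiv ℝ (gradient V) x₀).inverse (gradient G x₀)) (gradient G x₀) < H x₀) :
    ∀ᶠ p : ℝ × (E × E) in nhds (0, (x₀, x₀)),
      2 * V ((2⁻¹ : ℝ) • (p.2.1 + p.2.2)) ≤
        perturb V G H p.1 p.2.1 + perturb V G H (-p.1) p.2.2 := by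
  obtain ⟨c, hc, hQ⟩ := exists_pos_mul_norm_sq_le_block hpos
    (fun u v => inner_fderiv_gradient_comm hV u v) hlt
  set η := c / 4 with hη
  have hη0 : 0 < η := by positivity
  have ev1 := eventually_le_second_difference hVg (hasStrictFDerivAt_gradient hV) hη0
  have hG' : HasStrictFDerivAt G (fderiv ℝ G x₀) x₀ := hG.hasStrictFDerivAt (by norm_num)
  have ev2 := (hasStrictFDerivAt_iff_isLittleO.1 hG').bound hη0
  have ev3 : ∀ᶠ y in nhds x₀, H x₀ - η < H y := hH.eventually (lt_mem_nhds (by linarith))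
  have ev : ∀ᶠ q : E × E in nhds (x₀, x₀), _ := (ev1.and ev2).and (ev3.prodMk_nhds ev3)
  rw [nhds_prod_eq]
  filter_upwards [ev.prod_inr (nhds (0 : ℝ))] with p hp
  obtain ⟨s, x, y⟩ := p
  obtain ⟨⟨h1, h2⟩, h3, h4⟩ := hp
  dsimp only at *
  set d := (2⁻¹ : ℝ) • (x - y) with hd
  have exy : x - y = (2 : ℝ) • d := by rw [hd]; module
  rw [exy, map_smul, norm_smul, Real.norm_eq_abs, Real.norm_eq_abs, abs_two, smul_eq_mul,
    ← inner_gradient_left] at h2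
  have q := hQ d s
  have h5 : |s * (G x - G y - 2 * inner ℝ (gradient G x₀) d)| ≤ |s| * (η * (2 * ‖d‖)) := by
    rw [abs_mul]; gcongr
  have h6 := (abs_le.1 h5).1
  have h7 : 2 * (|s| * ‖d‖) ≤ ‖d‖ ^ 2 + s ^ 2 := by
    rw [← sq_abs s]; nlinarith [sq_nonneg (|s| - ‖d‖)]
  have h8 : s ^ 2 * (H x₀ - η) ≤ s ^ 2 / 2 * (H x + H y) := by
    have : 0 ≤ s ^ 2 := sq_nonneg s
    nlinarith
  have h9 : η * (2 * (|s| * ‖d‖)) ≤ η * (‖d‖ ^ 2 + s ^ 2) := by gcongr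
  have h10 : 0 ≤ c * (‖d‖ ^ 2 + s ^ 2) := by positivity
  simp only [perturb]
  have hc' : c = 4 * η := by rw [hη]; ring
  rw [hc'] at q h10
  nlinarith

/-- On a compact subset of `Ω`, perturbations of opposite sign of the potential have midpoint means
above `V`, uniformly for small parameters. -/
lemma eventually_two_mul_le_perturb {V G H : E → ℝ} {Ω K : Set E} (hΩ : IsOpen Ω)
    (hV : ContDiffOn ℝ 2 V Ω) (hconv : ConvexOn ℝ Ω V)
    (hpos : ∀ x ∈ Ω, ∀ h : E, h ≠ 0 → 0 < inner ℝ (fderiv ℝ (gradient V) x h) h)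
    (hG : ContDiffOn ℝ 1 G Ω) (hH : ContinuousOn H Ω)
    (hlt : ∀ x ∈ Ω,
      inner ℝ ((fderiv ℝ (gradient V) x).inverse (gradient G x)) (gradient G x) < H x)
    (hK : IsCompact K) (hKΩ : K ⊆ Ω) :
    ∀ᶠ s in nhds (0 : ℝ), ∀ x ∈ K, ∀ y ∈ K,
      2 * V ((2⁻¹ : ℝ) • (x + y)) ≤ perturb V G H s x + perturb V G H (-s) y := by
  have main := (hK.prod hK).eventually_forall_of_forall_eventually (x₀ := (0 : ℝ))
    (P := fun s q => 2 * V ((2⁻¹ : ℝ) • (q.1 + q.2)) ≤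
      perturb V G H s q.1 + perturb V G H (-s) q.2) ?_
  · filter_upwards [main] with s hs x hx y hy using hs (x, y) ⟨hx, hy⟩
  rintro ⟨x, y⟩ ⟨hxK, hyK⟩
  have hx : x ∈ Ω := hKΩ hxK
  have hy : y ∈ Ω := hKΩ hyK
  clear hxK hyK
  rcases eq_or_ne x y with rfl | hxy
  · exact eventually_two_mul_le_perturb_diag (hV.contDiffAt (hΩ.mem_nhds hx))
      (eventually_hasGradientAt hΩ (hV.of_le (by norm_num)) hx)
      (hG.contDiffAt (hΩ.mem_nhds hx)) (hH.continuousAt (hΩ.mem_nhds hx)) (hpos x hx) (hlt x hx)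
  · have hz : (2⁻¹ : ℝ) • (x + y) ∈ Ω := by
      rw [smul_add]
      exact hconv.1 hx hy (by norm_num) (by norm_num) (by norm_num)
    have cont : ∀ f : E → ℝ, ContinuousOn f Ω → ∀ z ∈ Ω, ContinuousAt f z := fun f hf z hz =>
      hf.continuousAt (hΩ.mem_nhds hz)
    have c1 : ContinuousAt (fun p : ℝ × (E × E) => perturb V G H p.1 p.2.1) (0, (x, y)) := by
      have a1 : ContinuousAt (fun p : ℝ × (E × E) => V p.2.1) (0, (x, y)) :=
        (cont V hV.continuousOn x hx).comp' (by fun_prop)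
      have a2 : ContinuousAt (fun p : ℝ × (E × E) => G p.2.1) (0, (x, y)) :=
        (cont G hG.continuousOn x hx).comp' (by fun_prop)
      have a3 : ContinuousAt (fun p : ℝ × (E × E) => H p.2.1) (0, (x, y)) :=
        (cont H hH x hx).comp' (by fun_prop)
      exact (a1.add (continuousAt_fst.mul a2)).add (((continuousAt_fst.pow 2).div_const 2).mul a3)
    have c2 : ContinuousAt (fun p : ℝ × (E × E) => perturb V G H (-p.1) p.2.2) (0, (x, y)) := by
      have a1 : ContinuousAt (fun p : ℝ × (E × E) => V p.2.2) (0, (x, y)) :=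
        (cont V hV.continuousOn y hy).comp' (by fun_prop)
      have a2 : ContinuousAt (fun p : ℝ × (E × E) => G p.2.2) (0, (x, y)) :=
        (cont G hG.continuousOn y hy).comp' (by fun_prop)
      have a3 : ContinuousAt (fun p : ℝ × (E × E) => H p.2.2) (0, (x, y)) :=
        (cont H hH y hy).comp' (by fun_prop)
      exact (a1.add (continuousAt_fst.neg.mul a2)).add
        (((continuousAt_fst.neg.pow 2).div_const 2).mul a3)
    have c3 : ContinuousAt (fun p : ℝ × (E × E) => 2 * V ((2⁻¹ : ℝ) • (p.2.1 + p.2.2)))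
        (0, (x, y)) :=
      ((cont V hV.continuousOn _ hz).comp'
        (f := fun p : ℝ × (E × E) => (2⁻¹ : ℝ) • (p.2.1 + p.2.2)) (by fun_prop)).const_mul 2
    have lt := two_mul_lt_of_hessian_pos hΩ hV hconv hpos hx hy hxy
    filter_upwards [c3.eventually_lt (c1.add c2) (by simpa [perturb] using lt)] with p hp
    exact hp.le

end Perturb

/-! ### The energy density -/

section Energy

variable {n : ℕ} {V G : EuclideanSpace ℝ (Fin n) → ℝ} {Ω : Set (EuclideanSpace ℝ (Fin n))}

lemma inner_inverse_nonneg {E : Type*} [NormedAddCommGroup E] [InnerProductSpace ℝ E]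
    [FiniteDimensional ℝ E] {A : E →L[ℝ] E} (hA : ∀ h, h ≠ 0 → 0 < inner ℝ (A h) h) (b : E) :
    0 ≤ inner ℝ (A.inverse b) b := by
  obtain ⟨e, rfl⟩ := exists_equiv_of_inner_pos hA
  rw [ContinuousLinearMap.inverse_equiv]
  rcases eq_or_ne b 0 with rfl | hb
  · simp
  have := hA (e.symm b) (by simpa using hb)
  rw [real_inner_comm] at this
  simpa using this.le

lemma continuousOn_inner_hessian_inverse (hΩ : IsOpen Ω) (hV : ContDiffOn ℝ 2 V Ω)
    (hpos : ∀ x ∈ Ω, ∀ h : EuclideanSpace ℝ (Fin n), h ≠ 0 → 0 < inner ℝ (hessian V x h) h)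
    (hG : ContDiffOn ℝ 1 G Ω) :
    ContinuousOn (fun x => inner ℝ ((hessian V x).inverse (gradient G x)) (gradient G x)) Ω := by
  have h1 : ContinuousOn (hessian V) Ω :=
    (hV.contDiffOn_gradient hΩ).continuousOn_fderiv_of_isOpen hΩ (by norm_num)
  have h2 : ContinuousOn (fun x => (hessian V x).inverse) Ω := by
    intro x hx
    obtain ⟨e, he⟩ := exists_equiv_of_inner_pos (hpos x hx)
    have : ContinuousAt ContinuousLinearMap.inverse (hessian V x) := by
      rw [← he]
      exact (contDiffAt_map_inverse (n := 0) e).continuousAt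
    exact this.comp_continuousWithinAt (h1 x hx)
  have h3 := hG.continuousOn_gradient hΩ
  exact (h2.clm_apply h3).inner h3

end Energy

/-! ### Second-order expansion of the mass of a compact set -/

/-- A function with non-negative symmetric second differences at `0` has a non-negative second
derivative there. -/
lemma nonneg_of_two_mul_le_add_neg {f f' : ℝ → ℝ} {c : ℝ}
    (hf : ∀ᶠ s in nhds 0, HasDerivAt f (f' s) s) (hf' : HasDerivAt f' c 0)
    (h : ∀ᶠ s in nhds 0, 2 * f 0 ≤ f s + f (-s)) : 0 ≤ c := by
  by_contra! hc
  have neg0 : Filter.Tendsto (fun s : ℝ => -s) (nhds 0) (nhds 0) := by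
    simpa using (continuous_neg (G := ℝ)).tendsto 0
  have hD : HasDerivAt (fun s => f' s - f' (-s)) (2 * c) 0 := by
    have h1 : HasDerivAt (fun s => f' (-s)) (-c) 0 := by
      simpa [Function.comp_def] using
        HasDerivAt.scomp_of_eq (0 : ℝ) hf' (hasDerivAt_neg (0 : ℝ)) (by simp)
    exact (hf'.sub h1).congr_deriv (by ring)
  have hslope := hasDerivAt_iff_tendsto_slope.1 hD
  have hneg : ∀ᶠ s in nhdsWithin (0 : ℝ) {0}ᶜ, slope (fun s => f' s - f' (-s)) 0 s < 0 :=
    hslope.eventually (gt_mem_nhds (by linarith))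
  rw [eventually_nhdsWithin_iff] at hneg
  obtain ⟨r, hr, H⟩ := Metric.eventually_nhds_iff_ball.1
    (((hf.and (neg0.eventually hf)).and hneg).and h)
  have mem : ∀ s ∈ Set.Icc 0 (r / 2), s ∈ Metric.ball (0 : ℝ) r := by
    intro s hs
    rw [mem_ball_zero_iff, Real.norm_eq_abs, abs_of_nonneg hs.1]
    linarith [hs.2]
  have der : ∀ s ∈ Set.Icc 0 (r / 2), HasDerivAt (fun s => f s + f (-s)) (f' s - f' (-s)) s := by
    intro s hs
    obtain ⟨⟨⟨h1, h2⟩, -⟩, -⟩ := H s (mem s hs)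
    have h3 : HasDerivAt (fun s => f (-s)) (-f' (-s)) s := by
      simpa [Function.comp_def] using h2.scomp s (hasDerivAt_neg s)
    exact (h1.add h3).congr_deriv (by ring)
  have anti := strictAntiOn_of_deriv_neg (convex_Icc (0 : ℝ) (r / 2))
    (fun s hs => (der s hs).continuousAt.continuousWithinAt) (fun s hs => by
      rw [(der s (interior_subset hs)).deriv]
      rw [interior_Icc] at hs
      have h1 := (H s (mem s (Set.Ioo_subset_Icc_self hs))).1.2 hs.1.ne'
      rw [slope_def_field] at h1
      simp only [neg_zero, sub_self, sub_zero] at h1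
      exact (div_neg_iff.1 h1).resolve_left (fun h => absurd h.2 (not_lt.2 hs.1.le)) |>.1)
  have h1 := anti (Set.left_mem_Icc.2 (by positivity)) (Set.right_mem_Icc.2 (by positivity))
    (by positivity : (0 : ℝ) < r / 2)
  have h2 := (H (r / 2) (mem _ (Set.right_mem_Icc.2 (by positivity)))).2
  simp only [neg_zero] at h1
  linarith

lemma hasDerivAt_setIntegral_of_continuousOn {E : Type*} [TopologicalSpace E] [T2Space E]
    [MeasurableSpace E] [BorelSpace E] {ν : Measure E} [IsFiniteMeasureOnCompacts ν] {K : Set E}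
    (hK : IsCompact K) {δ : ℝ} {f f' : ℝ → E → ℝ}
    (hf : ContinuousOn (fun p : ℝ × E => f p.1 p.2) (Set.Icc (-δ) δ ×ˢ K))
    (hf' : ContinuousOn (fun p : ℝ × E => f' p.1 p.2) (Set.Icc (-δ) δ ×ˢ K))
    (hd : ∀ s ∈ Set.Ioo (-δ) δ, ∀ x ∈ K, HasDerivAt (fun s => f s x) (f' s x) s)
    {s : ℝ} (hs : s ∈ Set.Ioo (-δ) δ) :
    HasDerivAt (fun s => ∫ x in K, f s x ∂ν) (∫ x in K, f' s x ∂ν) s := by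
  have slice : ∀ g : ℝ → E → ℝ,
      ContinuousOn (fun p : ℝ × E => g p.1 p.2) (Set.Icc (-δ) δ ×ˢ K) →
      ∀ t ∈ Set.Ioo (-δ) δ, ContinuousOn (g t) K := fun g hg t ht =>
    hg.comp (f := fun x : E => (t, x)) (by fun_prop) fun x hx => ⟨Set.Ioo_subset_Icc_self ht, hx⟩
  have hnhds : Set.Ioo (-δ) δ ∈ nhds s := isOpen_Ioo.mem_nhds hs
  obtain ⟨C, hC⟩ := (isCompact_Icc.prod hK).exists_bound_of_continuousOn hf'
  refine (hasDerivAt_integral_of_dominated_loc_of_deriv_le (bound := fun _ => C) hnhds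
    ?_ ?_ ?_ ?_ ?_ ?_).2
  · filter_upwards [hnhds] with t ht
    exact ((slice f hf t ht).integrableOn_compact hK).aestronglyMeasurable
  · exact (slice f hf s hs).integrableOn_compact hK
  · exact ((slice f' hf' s hs).integrableOn_compact hK).aestronglyMeasurable
  · exact (ae_restrict_mem hK.measurableSet).mono fun x hx t ht =>
      hC (t, x) ⟨Set.Ioo_subset_Icc_self ht, hx⟩
  · exact integrableOn_const hK.measure_ne_top
  · exact (ae_restrict_mem hK.measurableSet).mono fun x hx t ht => hd t ht x hx

lemma powMean_ofReal {β a b : ℝ} (ha : 0 < a) (hb : 0 < b) :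
    powMean β (ENNReal.ofReal a) (ENNReal.ofReal b) =
      ENNReal.ofReal (((a ^ (-1 / β) + b ^ (-1 / β)) / 2) ^ (-β)) := by
  have h1 := Real.rpow_pos_of_pos ha (-1 / β)
  have h2 := Real.rpow_pos_of_pos hb (-1 / β)
  rw [powMean, ENNReal.ofReal_rpow_of_pos ha, ENNReal.ofReal_rpow_of_pos hb,
    ← ENNReal.ofReal_add h1.le h2.le, ← ENNReal.ofReal_ofNat 2, ← ENNReal.ofReal_div_of_pos two_pos,
    ENNReal.ofReal_rpow_of_pos (by positivity)]

/-- The Borell–Brascamp–Lieb inequality for the powers `a ^ (-β)`, `b ^ (-β)`, `c ^ (-β)` of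
positive continuous functions on a compact convex set. -/
lemma two_mul_rpow_setIntegral_le {n : ℕ} {β : ℝ} (hβ : n < β)
    {a b c : EuclideanSpace ℝ (Fin n) → ℝ} {K : Set (EuclideanSpace ℝ (Fin n))}
    (hK : IsCompact K) (hKc : Convex ℝ K)
    (ha : ContinuousOn a K) (hb : ContinuousOn b K) (hc : ContinuousOn c K)
    (ha0 : ∀ x ∈ K, 0 < a x) (hb0 : ∀ x ∈ K, 0 < b x) (hc0 : ∀ x ∈ K, 0 < c x)
    (h : ∀ x ∈ K, ∀ y ∈ K, 2 * c ((2⁻¹ : ℝ) • (x + y)) ≤ a x + b y)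
    (hIa : 0 < ∫ x in K, a x ^ (-β)) (hIb : 0 < ∫ x in K, b x ^ (-β))
    (hIc : 0 < ∫ x in K, c x ^ (-β)) :
    2 * (∫ x in K, c x ^ (-β)) ^ (-1 / (β - n)) ≤
      (∫ x in K, a x ^ (-β)) ^ (-1 / (β - n)) + (∫ x in K, b x ^ (-β)) ^ (-1 / (β - n)) := by
  have hβ0 : 0 < β := (Nat.cast_nonneg n).trans_lt hβ
  have hγ : 0 < β - n := by linarith
  have hcont : ∀ f : EuclideanSpace ℝ (Fin n) → ℝ, ContinuousOn f K → (∀ x ∈ K, 0 < f x) →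
      ContinuousOn (fun x => f x ^ (-β)) K := fun f hf hf0 =>
    hf.rpow_const fun x hx => .inl (hf0 x hx).ne'
  have meas : ∀ f : EuclideanSpace ℝ (Fin n) → ℝ, ContinuousOn f K → (∀ x ∈ K, 0 < f x) →
      Measurable (K.indicator fun x => ENNReal.ofReal (f x ^ (-β))) := by
    classical
    intro f hf hf0
    rw [← Set.piecewise_eq_indicator]
    exact (ENNReal.continuous_ofReal.comp_continuousOn (hcont f hf hf0)).measurable_piecewise
      continuousOn_const hK.measurableSet
  have int : ∀ f : EuclideanSpace ℝ (Fin n) → ℝ, ContinuousOn f K → (∀ x ∈ K, 0 < f x) →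
      ∫⁻ x, K.indicator (fun x => ENNReal.ofReal (f x ^ (-β))) x =
        ENNReal.ofReal (∫ x in K, f x ^ (-β)) := by
    intro f hf hf0
    rw [lintegral_indicator hK.measurableSet, ofReal_integral_eq_lintegral_ofReal]
    · exact (hcont f hf hf0).integrableOn_compact hK
    · exact (ae_restrict_mem hK.measurableSet).mono fun x hx =>
        (Real.rpow_pos_of_pos (hf0 x hx) _).le
  have key := powMean_lintegral_le n hβ (meas a ha ha0) (meas b hb hb0) (meas c hc hc0) ?_
  · rw [int a ha ha0, int b hb hb0, int c hc hc0, powMean_ofReal hIa hIb,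
      ENNReal.ofReal_le_ofReal_iff hIc.le] at key
    set A := (∫ x in K, a x ^ (-β)) ^ (-1 / (β - n)) with hA
    set B := (∫ x in K, b x ^ (-β)) ^ (-1 / (β - n)) with hB
    have hA0 : 0 < A := Real.rpow_pos_of_pos hIa _
    have hB0 : 0 < B := Real.rpow_pos_of_pos hIb _
    have h2 := Real.rpow_le_rpow_of_nonpos (z := -1 / (β - n)) (by positivity) key
      (div_nonpos_of_nonpos_of_nonneg (by norm_num) hγ.le)
    rw [← Real.rpow_mul (by positivity), show -(β - n) * (-1 / (β - n)) = 1 by field_simp,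
      Real.rpow_one] at h2
    linarith
  · intro x y
    by_cases hx : x ∈ K
    swap; · simp [hx, powMean_zero_left hβ0]
    by_cases hy : y ∈ K
    swap; · simp [hy, powMean_zero_right hβ0]
    have hz : (2⁻¹ : ℝ) • (x + y) ∈ K := by
      rw [smul_add]
      exact hKc hx hy (by norm_num) (by norm_num) (by norm_num)
    rw [Set.indicator_of_mem hx, Set.indicator_of_mem hy, Set.indicator_of_mem hz,
      powMean_ofReal (Real.rpow_pos_of_pos (ha0 x hx) _) (Real.rpow_pos_of_pos (hb0 y hy) _),
      ← Real.rpow_mul (ha0 x hx).le, ← Real.rpow_mul (hb0 y hy).le,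
      show -β * (-1 / β) = 1 by field_simp, Real.rpow_one, Real.rpow_one]
    refine ENNReal.ofReal_le_ofReal (Real.rpow_le_rpow_of_nonpos (hc0 _ hz) ?_ (by linarith))
    linarith [h x hx y hy]

/-- The second variation of the inequality for `V + s G + s² H / 2` at `s = 0`: convexity of
`s ↦ I s ^ (-1 / (β - n))`, where `I s` is the integral of the power `-β`, is
`I 0 * I'' 0 ≤ (1 + 1 / (β - n)) * I' 0 ^ 2`. -/
lemma second_variation_le {n : ℕ} {β : ℝ} (hβ : n < β)
    {V G H : EuclideanSpace ℝ (Fin n) → ℝ} {K : Set (EuclideanSpace ℝ (Fin n))}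
    (hK : IsCompact K) (hKc : Convex ℝ K)
    (hV : ContinuousOn V K) (hG : ContinuousOn G K) (hH : ContinuousOn H K)
    (hV0 : ∀ x ∈ K, 0 < V x)
    (h : ∀ᶠ s in nhds (0 : ℝ), ∀ x ∈ K, ∀ y ∈ K,
      2 * V ((2⁻¹ : ℝ) • (x + y)) ≤ perturb V G H s x + perturb V G H (-s) y)
    (hI : 0 < ∫ x in K, V x ^ (-β)) :
    (∫ x in K, V x ^ (-β)) *
        (∫ x in K, (β * (β + 1) * V x ^ (-β - 2) * G x ^ 2 - β * V x ^ (-β - 1) * H x)) ≤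
      (1 + 1 / (β - n)) * (∫ x in K, -β * V x ^ (-β - 1) * G x) ^ 2 := by
  have hγ : 0 < β - n := by linarith
  obtain ⟨δ, hδ, posp⟩ : ∃ δ > 0, ∀ s ∈ Set.Icc (-δ) δ, ∀ x ∈ K, 0 < perturb V G H s x := by
    have hK0 : K.Nonempty := by
      rw [Set.nonempty_iff_ne_empty]
      rintro rfl
      simp at hI
    obtain ⟨x₀, hx₀, hmin⟩ := hK.exists_isMinOn hK0 hV
    obtain ⟨C, hC⟩ := hK.exists_bound_of_continuousOn hG
    obtain ⟨D, hD⟩ := hK.exists_bound_of_continuousOn hH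
    have ev : ∀ᶠ s in nhds (0 : ℝ), |s| * C + s ^ 2 / 2 * D < V x₀ := by
      have : Continuous fun s : ℝ => |s| * C + s ^ 2 / 2 * D := by fun_prop
      exact (this.tendsto 0).eventually (gt_mem_nhds (by simpa using hV0 x₀ hx₀))
    obtain ⟨r, hr, Hr⟩ := Metric.eventually_nhds_iff_ball.1 ev
    refine ⟨r / 2, by positivity, fun s hs x hx => ?_⟩
    have h1 := Hr s (by
      rw [mem_ball_zero_iff, Real.norm_eq_abs]
      exact (abs_le.2 hs).trans_lt (by linarith))
    have h2 : V x₀ ≤ V x := hmin hx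
    have h3 : |s * G x| ≤ |s| * C := by rw [abs_mul]; gcongr; exact hC x hx
    have h4 : |s ^ 2 / 2 * H x| ≤ s ^ 2 / 2 * D := by
      rw [abs_mul, abs_of_nonneg (by positivity : 0 ≤ s ^ 2 / 2)]; gcongr; exact hD x hx
    rw [perturb]
    linarith [(abs_le.1 h3).1, (abs_le.1 h4).1]
  have lift : ∀ f : EuclideanSpace ℝ (Fin n) → ℝ, ContinuousOn f K →
      ContinuousOn (fun p : ℝ × EuclideanSpace ℝ (Fin n) => f p.2) (Set.Icc (-δ) δ ×ˢ K) :=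
    fun f hf => hf.comp continuousOn_snd fun p hp => hp.2
  have contp : ContinuousOn (fun p : ℝ × EuclideanSpace ℝ (Fin n) => perturb V G H p.1 p.2)
      (Set.Icc (-δ) δ ×ˢ K) :=
    ((lift V hV).add (continuousOn_fst.mul (lift G hG))).add
      (((continuousOn_fst.pow 2).div_const 2).mul (lift H hH))
  have contpow : ∀ z : ℝ, ContinuousOn
      (fun p : ℝ × EuclideanSpace ℝ (Fin n) => perturb V G H p.1 p.2 ^ z) (Set.Icc (-δ) δ ×ˢ K) :=
    fun z => contp.rpow_const fun p hp => .inl (posp p.1 hp.1 p.2 hp.2).ne'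
  have contd : ContinuousOn (fun p : ℝ × EuclideanSpace ℝ (Fin n) => G p.2 + p.1 * H p.2)
      (Set.Icc (-δ) δ ×ˢ K) := (lift G hG).add (continuousOn_fst.mul (lift H hH))
  have derp : ∀ s x, HasDerivAt (fun s => perturb V G H s x) (G x + s * H x) s := by
    intro s x
    refine ((((hasDerivAt_id s).mul_const (G x)).const_add (V x)).add
      (((hasDerivAt_pow 2 s).div_const 2).mul_const (H x))).congr_deriv ?_
    norm_num
  have derpow : ∀ s ∈ Set.Ioo (-δ) δ, ∀ x ∈ K, ∀ z : ℝ, HasDerivAt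
      (fun s => perturb V G H s x ^ z) (z * perturb V G H s x ^ (z - 1) * (G x + s * H x)) s := by
    intro s hs x hx z
    exact ((derp s x).rpow_const (.inl (posp s (Set.Ioo_subset_Icc_self hs) x hx).ne')).congr_deriv
      (by ring)
  have d1 := fun s (hs : s ∈ Set.Ioo (-δ) δ) => hasDerivAt_setIntegral_of_continuousOn
    (ν := (volume : Measure (EuclideanSpace ℝ (Fin n)))) hK (δ := δ)
    (f := fun s x => perturb V G H s x ^ (-β))
    (f' := fun s x => -β * perturb V G H s x ^ (-β - 1) * (G x + s * H x))
    (contpow _) ((continuousOn_const.mul (contpow _)).mul contd)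
    (fun s hs x hx => derpow s hs x hx _) hs
  have d2 := fun s (hs : s ∈ Set.Ioo (-δ) δ) => hasDerivAt_setIntegral_of_continuousOn
    (ν := (volume : Measure (EuclideanSpace ℝ (Fin n)))) hK (δ := δ)
    (f := fun s x => -β * perturb V G H s x ^ (-β - 1) * (G x + s * H x))
    (f' := fun s x => β * (β + 1) * perturb V G H s x ^ (-β - 2) * (G x + s * H x) ^ 2 -
      β * perturb V G H s x ^ (-β - 1) * H x)
    ((continuousOn_const.mul (contpow _)).mul contd)
    (((continuousOn_const.mul (contpow _)).mul (contd.pow 2)).sub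
      ((continuousOn_const.mul (contpow _)).mul (lift H hH)))
    (fun s hs x hx => by
      have e := ((derpow s hs x hx (-β - 1)).const_mul (-β)).mul
        (((hasDerivAt_id s).mul_const (H x)).const_add (G x))
      refine e.congr_deriv ?_
      rw [show -β - 1 - 1 = -β - 2 by ring]
      simp only [id]
      ring) hs
  have h0δ : (0 : ℝ) ∈ Set.Ioo (-δ) δ := ⟨by linarith, hδ⟩
  have nhdsδ : Set.Ioo (-δ) δ ∈ nhds (0 : ℝ) := isOpen_Ioo.mem_nhds h0δ
  have p0 : ∀ x, perturb V G H 0 x = V x := fun x => by simp [perturb]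
  set I : ℝ → ℝ := fun s => ∫ x in K, perturb V G H s x ^ (-β) with hIdef
  set J : ℝ → ℝ := fun s => ∫ x in K, -β * perturb V G H s x ^ (-β - 1) * (G x + s * H x) with hJ
  set L := ∫ x in K, (β * (β + 1) * V x ^ (-β - 2) * G x ^ 2 - β * V x ^ (-β - 1) * H x) with hL
  have hI0 : ∫ x in K, V x ^ (-β) = I 0 := by simp only [hIdef, p0]
  have hJ0 : ∫ x in K, -β * V x ^ (-β - 1) * G x = J 0 := by simp [hJ, p0]
  have hJL : HasDerivAt J L 0 := (d2 0 h0δ).congr_deriv (by simp [hL, p0])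
  have hIpos : ∀ᶠ s in nhds (0 : ℝ), 0 < I s :=
    (d1 0 h0δ).continuousAt.eventually (lt_mem_nhds (by rw [← hI0]; exact hI))
  have hneg : Filter.Tendsto (fun s : ℝ => -s) (nhds 0) (nhds 0) := by
    simpa using (continuous_neg (G := ℝ)).tendsto 0
  rw [hI0] at hI ⊢
  rw [hJ0]
  have hΦ : ∀ᶠ s in nhds (0 : ℝ), HasDerivAt (fun s => I s ^ (-1 / (β - n)))
      (J s * (-1 / (β - n)) * I s ^ (-1 / (β - n) - 1)) s := by
    filter_upwards [hIpos, nhdsδ] with s hs hsδ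
    exact (d1 s hsδ).rpow_const (.inl hs.ne')
  have hΦ' := (hJL.mul_const (-1 / (β - n))).mul
    ((d1 0 h0δ).rpow_const (p := -1 / (β - n) - 1) (.inl hI.ne'))
  have mid : ∀ᶠ s in nhds (0 : ℝ),
      2 * I 0 ^ (-1 / (β - n)) ≤ I s ^ (-1 / (β - n)) + I (-s) ^ (-1 / (β - n)) := by
    filter_upwards [h, hIpos, hneg.eventually hIpos, nhdsδ] with s hs hs1 hs2 hsδ
    have hsδ' : -s ∈ Set.Icc (-δ) δ := ⟨by linarith [hsδ.2], by linarith [hsδ.1]⟩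
    have cont : ∀ t ∈ Set.Icc (-δ) δ, ContinuousOn (perturb V G H t) K := fun t ht =>
      contp.comp (f := fun x => (t, x)) (by fun_prop) fun x hx => ⟨ht, hx⟩
    rw [← hI0]
    exact two_mul_rpow_setIntegral_le hβ hK hKc (cont s (Set.Ioo_subset_Icc_self hsδ))
      (cont (-s) hsδ') hV (posp s (Set.Ioo_subset_Icc_self hsδ)) (posp (-s) hsδ') hV0 hs hs1 hs2
      (by rw [hI0]; exact hI)
  have fin := nonneg_of_two_mul_le_add_neg hΦ hΦ' mid
  have hp : 0 < I 0 ^ (-1 / (β - n) - 1 - 1) := Real.rpow_pos_of_pos hI _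
  have e : I 0 ^ (-1 / (β - n) - 1) = I 0 ^ (-1 / (β - n) - 1 - 1) * I 0 := by
    conv_rhs => rw [← Real.rpow_add_one hI.ne']
    congr 1; ring
  change 0 ≤ L * (-1 / (β - n)) * I 0 ^ (-1 / (β - n) - 1) + J 0 * (-1 / (β - n)) *
    (J 0 * (-1 / (β - n) - 1) * I 0 ^ (-1 / (β - n) - 1 - 1)) at fin
  rw [e] at fin
  set p := I 0 ^ (-1 / (β - n) - 1 - 1)
  have fin2 : 0 ≤ (p / (β - n)) * ((1 + 1 / (β - n)) * J 0 ^ 2 - I 0 * L) := by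
    refine fin.trans_eq ?_
    ring
  have := nonneg_of_mul_nonneg_right fin2 (by positivity)
  linarith

/-! ### Passage to the measure on `Ω` -/

section PowerMeasure

variable {n : ℕ} {V : EuclideanSpace ℝ (Fin n) → ℝ} {β : ℝ}
  {Ω K : Set (EuclideanSpace ℝ (Fin n))}

lemma aemeasurable_rpow_density (hΩ : IsOpen Ω) (hV : ContinuousOn V Ω)
    (hV0 : ∀ x ∈ Ω, 0 < V x) :
    AEMeasurable (fun x => ENNReal.ofReal (V x ^ (-β))) (volume.restrict Ω) :=
  ((hV.rpow_const fun x hx => .inl (hV0 x hx).ne').aemeasurable hΩ.measurableSet).ennreal_ofReal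

lemma setIntegral_powerMeasure (hΩ : IsOpen Ω) (hV : ContinuousOn V Ω) (hV0 : ∀ x ∈ Ω, 0 < V x)
    (hK : MeasurableSet K) (hKΩ : K ⊆ Ω) (f : EuclideanSpace ℝ (Fin n) → ℝ) :
    ∫ x in K, f x ∂(powerMeasure Ω V β) = ∫ x in K, V x ^ (-β) * f x := by
  have hr : (volume.restrict Ω).restrict K =
      (volume : Measure (EuclideanSpace ℝ (Fin n))).restrict K :=
    Measure.restrict_restrict_of_subset hKΩ
  have hm : AEMeasurable (fun x => ENNReal.ofReal (V x ^ (-β)))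
      ((volume.restrict Ω).restrict K) :=
    (aemeasurable_rpow_density hΩ hV hV0).restrict
  rw [powerMeasure, setIntegral_withDensity_eq_setIntegral_toReal_smul₀ hm (by simp) f hK, hr]
  refine setIntegral_congr_fun hK fun x hx => ?_
  simp only [smul_eq_mul]
  rw [ENNReal.toReal_ofReal (Real.rpow_pos_of_pos (hV0 x (hKΩ hx)) _).le]

lemma powerMeasure_compl (hΩ : MeasurableSet Ω) : powerMeasure Ω V β Ωᶜ = 0 :=
  withDensity_absolutelyContinuous _ _ (by simp [Measure.restrict_apply hΩ.compl])

/-- An open convex set is the union of an increasing sequence of compact convex sets: the points at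
distance at least `1 / (m + 1)` from the complement, intersected with balls. -/
lemma exists_monotone_compact_convex (hΩ : IsOpen Ω) (hΩc : Convex ℝ Ω) :
    ∃ K : ℕ → Set (EuclideanSpace ℝ (Fin n)), Monotone K ∧ (∀ m, IsCompact (K m)) ∧
      (∀ m, Convex ℝ (K m)) ∧ ⋃ m, K m = Ω := by
  let r : ℕ → ℝ := fun m => 1 / (m + 1)
  let S : ℕ → Set (EuclideanSpace ℝ (Fin n)) := fun m => {x | Metric.ball x (r m) ⊆ Ω}
  have hr : ∀ m, 0 < r m := fun m => Nat.one_div_pos_of_nat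
  have hranti : ∀ i j, i ≤ j → r j ≤ r i := fun i j hij => Nat.one_div_le_one_div hij
  have hSclosed : ∀ m, IsClosed (S m) := by
    intro m
    refine isClosed_of_closure_subset fun x hx w hw => ?_
    obtain ⟨y, hy, hxy⟩ := Metric.mem_closure_iff.1 hx (r m - dist w x) (sub_pos.2 hw)
    refine hy ?_
    have := dist_triangle w x y
    rw [Metric.mem_ball]
    linarith
  have hSconv : ∀ m, Convex ℝ (S m) := by
    intro m x hx y hy a b ha hb hab w hw
    have hsum : w = a • (x + (w - (a • x + b • y))) + b • (y + (w - (a • x + b • y))) := by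
      have : w = (a + b) • w + (1 - (a + b)) • (a • x + b • y) := by rw [hab]; module
      conv_lhs => rw [this]
      module
    have hd : ‖w - (a • x + b • y)‖ < r m := by rwa [← dist_eq_norm]
    rw [hsum]
    exact hΩc (hx (by simpa using hd)) (hy (by simpa using hd)) ha hb hab
  refine ⟨fun m => S m ∩ Metric.closedBall 0 m, fun i j hij => ?_, fun m => ?_, fun m => ?_, ?_⟩
  · exact Set.inter_subset_inter (fun x hx => (Metric.ball_subset_ball (hranti i j hij)).trans hx)
      (Metric.closedBall_subset_closedBall (by exact_mod_cast hij))
  · exact (isCompact_closedBall _ _).inter_left (hSclosed m)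
  · exact (hSconv m).inter (convex_closedBall _ _)
  · refine Set.Subset.antisymm
      (Set.iUnion_subset fun m x hx => hx.1 (Metric.mem_ball_self (hr m))) fun x hx => ?_
    obtain ⟨ε, hε, hball⟩ := Metric.isOpen_iff.1 hΩ x hx
    obtain ⟨k, hk⟩ := exists_nat_one_div_lt hε
    refine Set.mem_iUnion.2 ⟨max k ⌈‖x‖⌉₊, fun w hw => hball ?_, ?_⟩
    · exact Metric.ball_subset_ball ((hranti _ _ (le_max_left _ _)).trans hk.le) hw
    · rw [mem_closedBall_zero_iff]
      exact (Nat.le_ceil _).trans (by exact_mod_cast le_max_right _ _)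

/-- The weighted Poincaré inequality on a compact convex subset of `Ω`, for the restriction of the
measure, which need not be normalized. -/
lemma poincare_on_compact (hβ : n < β) (hΩ : IsOpen Ω) (hV0 : ∀ x ∈ Ω, 0 < V x)
    (hV : ContDiffOn ℝ 2 V Ω) (hconv : ConvexOn ℝ Ω V)
    (hpos : ∀ x ∈ Ω, ∀ h : EuclideanSpace ℝ (Fin n), h ≠ 0 → 0 < inner ℝ (hessian V x h) h)
    {g : EuclideanSpace ℝ (Fin n) → ℝ} (hg : ContDiffOn ℝ 1 g Ω)
    (hK : IsCompact K) (hKc : Convex ℝ K) (hKΩ : K ⊆ Ω) (hK0 : 0 < (powerMeasure Ω V β).real K) :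
    (β + 1) * ∫ x in K, g x ^ 2 ∂(powerMeasure Ω V β) ≤
      ∫ x in K, energyDensity V (fun y => V y * g y) x ∂(powerMeasure Ω V β) +
        β * (1 + 1 / (β - n)) * ((∫ x in K, g x ∂(powerMeasure Ω V β)) ^ 2 /
          (powerMeasure Ω V β).real K) := by
  have hβ0 : 0 < β := (Nat.cast_nonneg n).trans_lt hβ
  have hγ : 0 < β - n := by linarith
  set G : EuclideanSpace ℝ (Fin n) → ℝ := fun y => V y * g y with hGdef
  have hG : ContDiffOn ℝ 1 G Ω := (hV.of_le (by norm_num)).mul hg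
  set e : EuclideanSpace ℝ (Fin n) → ℝ := fun x =>
    inner ℝ ((hessian V x).inverse (gradient G x)) (gradient G x) with he
  have hec : ContinuousOn e Ω := continuousOn_inner_hessian_inverse hΩ hV hpos hG
  have hm := hK.measurableSet
  have tr := fun f => setIntegral_powerMeasure (β := β) hΩ hV.continuousOn hV0 hm hKΩ f
  have hVK : ∀ x ∈ K, 0 < V x := fun x hx => hV0 x (hKΩ hx)
  have hVc : ContinuousOn V K := hV.continuousOn.mono hKΩ
  have hgc : ContinuousOn g K := hg.continuousOn.mono hKΩ
  have hpow : ∀ z : ℝ, ContinuousOn (fun x => V x ^ z) K := fun z =>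
    hVc.rpow_const fun x hx => .inl (hVK x hx).ne'
  have mass : (powerMeasure Ω V β).real K = ∫ x in K, V x ^ (-β) := by
    have := tr fun _ => 1
    simpa using this
  set μ := powerMeasure Ω V β with hμ
  set P := ∫ x in K, V x ^ (-β - 1) with hP
  have hP0 : 0 ≤ P := setIntegral_nonneg hm fun x hx => (Real.rpow_pos_of_pos (hVK x hx) _).le
  -- Each continuous `H = e + η` is admissible in the second variation inequality.
  have key : ∀ η > 0, (β + 1) * ∫ x in K, g x ^ 2 ∂μ ≤
      (∫ x in K, energyDensity V G x ∂μ +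
        β * (1 + 1 / (β - n)) * ((∫ x in K, g x ∂μ) ^ 2 / μ.real K)) + η * P := by
    intro η hη
    have ev := eventually_two_mul_le_perturb (H := fun x => e x + η) hΩ hV hconv hpos hG
      (hec.add continuousOn_const) (fun x _ => lt_add_of_pos_right _ hη) hK hKΩ
    have sv := second_variation_le (H := fun x => e x + η) hβ hK hKc hVc (hG.continuousOn.mono hKΩ)
      ((hec.add continuousOn_const).mono hKΩ) hVK ev (by rw [← mass]; exact hK0)
    have r1 : ∫ x in K, -β * V x ^ (-β - 1) * G x = -β * ∫ x in K, g x ∂μ := by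
      rw [tr, ← integral_const_mul]
      refine setIntegral_congr_fun hm fun x hx => ?_
      simp only [hGdef]
      rw [Real.rpow_sub_one (hVK x hx).ne']
      field_simp [(hVK x hx).ne']
    have r2 : ∫ x in K, (β * (β + 1) * V x ^ (-β - 2) * G x ^ 2 - β * V x ^ (-β - 1) * (e x + η)) =
        β * (β + 1) * ∫ x in K, g x ^ 2 ∂μ - β * ∫ x in K, energyDensity V G x ∂μ -
          β * (η * P) := by
      have c1 : IntegrableOn (fun x => β * (β + 1) * (V x ^ (-β) * g x ^ 2)) K :=
        (continuousOn_const.mul ((hpow _).mul (hgc.pow 2))).integrableOn_compact hK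
      have c2 : IntegrableOn (fun x => β * (V x ^ (-β) * energyDensity V G x)) K :=
        (continuousOn_const.mul ((hpow _).mul
          ((hec.mono hKΩ).div hVc fun x hx => (hVK x hx).ne'))).integrableOn_compact hK
      have c3 : IntegrableOn (fun x => β * (η * V x ^ (-β - 1))) K :=
        (continuousOn_const.mul (continuousOn_const.mul (hpow _))).integrableOn_compact hK
      have c12 : IntegrableOn (fun x => β * (β + 1) * (V x ^ (-β) * g x ^ 2) -
          β * (V x ^ (-β) * energyDensity V G x)) K := c1.sub c2
      rw [tr, tr, hP, ← integral_const_mul, ← integral_const_mul, ← integral_const_mul,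
        ← integral_const_mul, ← integral_sub c1 c2, ← integral_sub c12 c3]
      refine setIntegral_congr_fun hm fun x hx => ?_
      have hx0 := (hVK x hx).ne'
      simp only [hGdef, energyDensity, he, show -β - 2 = -β - 1 - 1 by ring,
        Real.rpow_sub_one hx0]
      field_simp
      ring
    rw [r1, r2, ← mass] at sv
    have : β * (μ.real K * ((β + 1) * ∫ x in K, g x ^ 2 ∂μ)) ≤ β * (μ.real K *
        (∫ x in K, energyDensity V G x ∂μ + η * P) +
          β * ((1 + 1 / (β - n)) * (∫ x in K, g x ∂μ) ^ 2)) := by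
      nlinarith
    have := le_of_mul_le_mul_left this hβ0
    refine le_of_mul_le_mul_left (this.trans_eq ?_) hK0
    field_simp
    ring
  refine le_of_forall_pos_le_add fun ε hε => ?_
  refine (key (ε / (P + 1)) (by positivity)).trans (add_le_add le_rfl ?_)
  rw [div_mul_eq_mul_div, div_le_iff₀ (by positivity)]
  nlinarith

/-- The weighted Poincaré inequality in terms of real integrals, under finiteness of the energy. -/
lemma poincare_of_integrable (hβ : n < β) (hΩ : IsOpen Ω) (hΩc : Convex ℝ Ω)
    (hV0 : ∀ x ∈ Ω, 0 < V x) (hV : ContDiffOn ℝ 2 V Ω) (hconv : ConvexOn ℝ Ω V)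
    (hpos : ∀ x ∈ Ω, ∀ h : EuclideanSpace ℝ (Fin n), h ≠ 0 → 0 < inner ℝ (hessian V x h) h)
    (hμ : IsProbabilityMeasure (powerMeasure Ω V β))
    {g : EuclideanSpace ℝ (Fin n) → ℝ} (hg : ContDiffOn ℝ 1 g Ω)
    (hg2 : MemLp g 2 (powerMeasure Ω V β))
    (hE : Integrable (energyDensity V fun y => V y * g y) (powerMeasure Ω V β)) :
    (β + 1) * variance g (powerMeasure Ω V β) ≤
      ∫ x, energyDensity V (fun y => V y * g y) x ∂(powerMeasure Ω V β) +
        n / (β - n) * (∫ x, g x ∂(powerMeasure Ω V β)) ^ 2 := by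
  obtain ⟨K, hmono, hKcomp, hKconv, hKU⟩ := exists_monotone_compact_convex hΩ hΩc
  have hKΩ : ∀ m, K m ⊆ Ω := fun m => hKU ▸ Set.subset_iUnion K m
  set μ := powerMeasure Ω V β with hμdef
  have hΩae : μ.restrict Ω = μ :=
    Measure.restrict_eq_self_of_ae_mem (mem_ae_iff.2 (powerMeasure_compl hΩ.measurableSet))
  have lim : ∀ f : EuclideanSpace ℝ (Fin n) → ℝ, Integrable f μ →
      Filter.Tendsto (fun m => ∫ x in K m, f x ∂μ) Filter.atTop (nhds (∫ x, f x ∂μ)) := by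
    intro f hf
    have := tendsto_setIntegral_of_monotone (μ := μ) (f := f)
      (fun m => (hKcomp m).measurableSet) hmono hf.integrableOn
    rwa [hKU, hΩae] at this
  have lim1 : Filter.Tendsto (fun m => μ.real (K m)) Filter.atTop (nhds 1) := by
    simpa using lim (fun _ => 1) (integrable_const 1)
  have limg := lim g (hg2.integrable (by norm_num))
  have limg2 := lim (fun x => g x ^ 2) hg2.integrable_sq
  have main := le_of_tendsto_of_tendsto (limg2.const_mul (β + 1))
    ((lim _ hE).add (((limg.pow 2).div lim1 one_ne_zero).const_mul (β * (1 + 1 / (β - n))))) (by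
      filter_upwards [lim1.eventually (lt_mem_nhds one_pos)] with m hm
      exact poincare_on_compact hβ hΩ hV0 hV hconv hpos hg (hKcomp m) (hKconv m) (hKΩ m) hm)
  have hvar : variance g μ = ∫ x, g x ^ 2 ∂μ - (∫ x, g x ∂μ) ^ 2 := variance_eq_sub hg2
  have hγ : β - n ≠ 0 := by linarith
  have coef : β * (1 + 1 / (β - n)) - (β + 1) = n / (β - n) := by field_simp; ring
  rw [hvar, ← coef]
  linarith

end PowerMeasure

theorem theorem2p3 (n : ℕ) (Ω : Set (EuclideanSpace ℝ (Fin n)))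
    (V : EuclideanSpace ℝ (Fin n) → ℝ) (β : ℝ)
    (hΩ_open : IsOpen Ω) (hΩ_convex : Convex ℝ Ω)
    (hβ : (n : ℝ) < β)
    (hV_pos : ∀ x ∈ Ω, 0 < V x)
    (hV_smooth : ContDiffOn ℝ 2 V Ω)
    (hV_convex : ConvexOn ℝ Ω V)
    (hV_hess : ∀ x ∈ Ω, ∀ h : EuclideanSpace ℝ (Fin n), h ≠ 0 → 0 < inner ℝ (hessian V x h) h)
    (hμ : IsProbabilityMeasure (powerMeasure Ω V β))
    (g : EuclideanSpace ℝ (Fin n) → ℝ)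
    (hg_smooth : ContDiffOn ℝ ∞ g Ω)
    (hg_sq : MemLp g 2 (powerMeasure Ω V β)) :
    ENNReal.ofReal ((β + 1) * variance g (powerMeasure Ω V β)) ≤
        (∫⁻ x, ENNReal.ofReal (energyDensity V (fun y => V y * g y) x) ∂(powerMeasure Ω V β)) +
          ENNReal.ofReal ((n : ℝ) / (β - n) * (∫ x, g x ∂(powerMeasure Ω V β)) ^ 2) ∧
      ((∫ x, g x ∂(powerMeasure Ω V β)) = 0 →
        ENNReal.ofReal (variance g (powerMeasure Ω V β)) ≤
          ENNReal.ofReal (1 / (β + 1)) *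
            ∫⁻ x, ENNReal.ofReal (energyDensity V (fun y => V y * g y) x)
              ∂(powerMeasure Ω V β)) := by
  set μ := powerMeasure Ω V β with hμdef
  set G : EuclideanSpace ℝ (Fin n) → ℝ := fun y => V y * g y with hGdef
  have hβ1 : 0 < β + 1 := by linarith [(Nat.cast_nonneg n : (0 : ℝ) ≤ n)]
  have hg1 : ContDiffOn ℝ 1 g Ω := hg_smooth.of_le (by norm_num)
  have hG : ContDiffOn ℝ 1 G Ω := (hV_smooth.of_le (by norm_num)).mul hg1
  have hnn : 0 ≤ᵐ[μ] energyDensity V G := by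
    have hΩae : ∀ᵐ x ∂μ, x ∈ Ω := mem_ae_iff.2 (powerMeasure_compl hΩ_open.measurableSet)
    filter_upwards [hΩae] with x hx
    exact div_nonneg (inner_inverse_nonneg (hV_hess x hx) _) (hV_pos x hx).le
  have hmeas : AEStronglyMeasurable (energyDensity V G) μ :=
    (((continuousOn_inner_hessian_inverse hΩ_open hV_smooth hV_hess hG).div hV_smooth.continuousOn
      fun x hx => (hV_pos x hx).ne').aestronglyMeasurable hΩ_open.measurableSet).mono_ac
      (withDensity_absolutelyContinuous _ _)
  have first : ENNReal.ofReal ((β + 1) * variance g μ) ≤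
      (∫⁻ x, ENNReal.ofReal (energyDensity V G x) ∂μ) +
        ENNReal.ofReal ((n : ℝ) / (β - n) * (∫ x, g x ∂μ) ^ 2) := by
    rcases eq_or_ne (∫⁻ x, ENNReal.ofReal (energyDensity V G x) ∂μ) ⊤ with htop | htop
    · rw [htop, top_add]
      exact le_top
    · have hE := (lintegral_ofReal_ne_top_iff_integrable hmeas hnn).1 htop
      have hc : 0 ≤ (n : ℝ) / (β - n) * (∫ x, g x ∂μ) ^ 2 :=
        mul_nonneg (div_nonneg (Nat.cast_nonneg n) (by linarith)) (sq_nonneg _)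
      rw [← ofReal_integral_eq_lintegral_ofReal hE hnn,
        ← ENNReal.ofReal_add (integral_nonneg_of_ae hnn) hc]
      exact ENNReal.ofReal_le_ofReal (poincare_of_integrable hβ hΩ_open hΩ_convex hV_pos hV_smooth
        hV_convex hV_hess hμ hg1 hg_sq hE)
  refine ⟨first, fun h0 => ?_⟩
  rw [h0] at first
  have e : ENNReal.ofReal (variance g μ) =
      ENNReal.ofReal (1 / (β + 1)) * ENNReal.ofReal ((β + 1) * variance g μ) := by
    rw [← ENNReal.ofReal_mul (by positivity)]
    congr 1
    field_simp
  rw [e]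
  gcongr
  simpa using first
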